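/- For each $k\ge 1$ consider a pure exploration problem with $k$ alternatives. Alternative $i$ of the $k$-th problem has a distribution (that of $X_i$) with mean $\mu_i$ and variance $\sigma_i^2$; these distributions may depend on $k$, except that the distribution of alternative $1$ does not. The observations $X_{i,1},X_{i,2},\dots$ of alternative $i$ are i.i.d. copies of $X_i$, and different alternatives are sampled independently. Let $f:\{1,2,\dots\}\to[0,\infty)$ satisfy $\lim_{n\to\infty}f(n)=0$, and let $U_i(n)=\frac1n\sum_{j=1}^nX_{i,j}+f(n)$. The meta-UCB algorithm with total budget $B$ takes one observation of each alternative; then, while the total number of observations is less than $B$, it takes one more observation from an alternative $i$ that maximizes $U_i(n_i)$, where $n_i$ is the current sample size of alternative $i$; finally it outputs an alternative with the largest sample size. Ties are broken arbitrarily. Let $\mathrm{PCS}$ be the probability that the output is alternative $1$, and let $U_1^*=\inf_{n\ge1}U_1(n)$. Assume: (1) every $X_i$ has a continuous distribution, and there are $q>3$ and $M>0$ with $\mathrm E|X_i|^q\le M$ for all $i\le k$ and all $k$; (2) there are $\gamma,\underline\sigma^2,\bar\sigma^2>0$ such that $\mu_1-\mu_i\ge\gamma$ for $2\le i\le k$ and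 $\underline\sigma^2\le\sigma_i^2\le\bar\sigma^2$ for $1\le i\le k$, for all $k$. For $b>0$ let $n^f(b)$ be a positive integer such that $f(n)<b$ for all $n\ge n^f(b)$, where the choice is constant on some interval $(\gamma/2-\varepsilon,\gamma/2]$ (as it is when $n^f(b)$ is the least such integer). Let $$C(b;n)=c_1b^{-q}n^{-q+2}+\frac{e^{-nc_2b^2}}{1-e^{-c_2b^2}}+n,\qquad c_1=\Big(2+\frac4q\Big)^qM\,\frac{q-1}{q-2},\qquad c_2=\frac{M^{-2/q}}{2(q+2)^{2}e^{q}} .$$ Let $c>2C(\gamma/2;n^f(\gamma/2))$ and let the total budget be $B=ck$ (rounded up or down to an integer). Then the supremum $$\gamma_0=\sup\{g\in(0,\gamma):\ 2C((\gamma-g)/2;\,n^f((\gamma-g)/2))\le c\}$$ is over a nonempty set, and $$\liminf_{k\to\infty}\mathrm{PCS}\ \ge\ \Pr\{U_1^*\ge\mu_1-\gamma_0\}\ >\ 0 .$$ In particular the meta-UCB algorithm is sample optimal: there is $\alpha\in(0,1)$ with $\liminf_{k\to\infty}\mathrm{PCS}>\alpha$ for $B=ck$. -/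

import Mathlib

open MeasureTheory ProbabilityTheory Filter Topology

noncomputable section

/-- The sample mean of the first `n` observations `x 0, …, x (n - 1)` of an alternative. -/
def sampleMean (x : ℕ → ℝ) (n : ℕ) : ℝ := (∑ j ∈ Finset.range n, x j) / n

/-- The UCB value after `n ≥ 1` observations, with exploration bonus function `f`. -/
def ucb (f : ℕ → ℝ) (x : ℕ → ℝ) (n : ℕ) : ℝ := sampleMean x n + f n

/-- The minimum `U^* = inf_{n ≥ 1} U(n)` of a UCB value process, as an extended real. -/
def ucbInf (f : ℕ → ℝ) (x : ℕ → ℝ) : EReal := ⨅ n : ℕ, ⨅ _ : 1 ≤ n, (ucb f x n : EReal)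

/-- The exploration bonus function is nonnegative and vanishes as the sample size grows. -/
structure IsBonus (f : ℕ → ℝ) : Prop where
  nonneg : ∀ n, 1 ≤ n → 0 ≤ f n
  tendsto_zero : Tendsto f atTop (𝓝 0)

/-- Sample-size vectors that the meta-UCB loop can be at, on the observations `x i j` (`x i j` is
what the `(j+1)`-st sampling of alternative `i` returns), under a total budget `B`. First every
alternative is sampled once; then, as long as the total sample size is below `B`, an alternative
with the largest UCB value is sampled once more. Ties may be broken in any way. -/
inductive MetaUCBReachable {ι : Type*} [Fintype ι] [DecidableEq ι]
    (f : ℕ → ℝ) (x : ι → ℕ → ℝ) (B : ℕ) : (ι → ℕ) → Prop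
  | init : MetaUCBReachable f x B (fun _ => 1)
  | step (n : ι → ℕ) (s : ι) (hn : MetaUCBReachable f x B n) (hB : ∑ i, n i < B)
      (hs : ∀ i, ucb f (x i) (n i) ≤ ucb f (x s) (n s)) :
      MetaUCBReachable f x B (Function.update n s (n s + 1))

/-- The meta-UCB algorithm may output alternative `b`: the loop has ended, and `b` has the largest
sample size. Ties may be broken in any way. -/
def MetaUCBOutputs {ι : Type*} [Fintype ι] [DecidableEq ι]
    (f : ℕ → ℝ) (x : ι → ℕ → ℝ) (B : ℕ) (b : ι) : Prop :=
  ∃ n : ι → ℕ, MetaUCBReachable f x B n ∧ B ≤ ∑ i, n i ∧ ∀ i, n i ≤ n b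

/-- The observations `X i j`, `j = 0, 1, …`, of alternative `i` are i.i.d. with distribution `ν i`,
and different alternatives are sampled independently. -/
structure IsSampling {ι Ω : Type*} [MeasurableSpace Ω] (P : Measure Ω)
    (ν : ι → Measure ℝ) (X : ι → ℕ → Ω → ℝ) : Prop where
  hasLaw : ∀ i j, HasLaw (X i j) (ν i) P
  indep : iIndepFun (fun p : ι × ℕ => X p.1 p.2) P

def momentA₁ (q M : ℝ) : ℝ := (2 + 4 / q) ^ q * M

def momentA₂ (q M : ℝ) : ℝ := (q + 2) ^ (-2 : ℝ) * Real.exp (-q) * M ^ (-2 / q) / 2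

def momentC₁ (q M : ℝ) : ℝ := momentA₁ q M * ((q - 1) / (q - 2))

def momentC₂ (q M : ℝ) : ℝ := momentA₂ q M

/-- `C(b; n) = c₁ b^{-q} n^{-q+2} + exp(-n c₂ b²) / (1 - exp(-c₂ b²)) + n`. -/
def momentC (q M b : ℝ) (n : ℕ) : ℝ :=
  momentC₁ q M * b ^ (-q) * (n : ℝ) ^ (-q + 2)
    + Real.exp (-(n * momentC₂ q M * b ^ 2)) / (1 - Real.exp (-(momentC₂ q M * b ^ 2))) + n

/-- `N` is a positive integer such that `f n < b` for all `n ≥ N`. -/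
def IsThreshold (f : ℕ → ℝ) (b : ℝ) (N : ℕ) : Prop := 1 ≤ N ∧ ∀ n, N ≤ n → f n < b

/-- The `g ∈ (0, γ)` with `2 C((γ - g)/2; n^f((γ - g)/2)) ≤ c`, for a choice `nf` of `n^f`. -/
def admissibleSet (q M γ c : ℝ) (nf : ℝ → ℕ) : Set ℝ :=
  {g | g ∈ Set.Ioo 0 γ ∧ 2 * momentC q M ((γ - g) / 2) (nf ((γ - g) / 2)) ≤ c}

end

/-!
Fix `g` and put `a = μ₁ - g`. While `U₁` stays above `a`, the algorithm samples a suboptimal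
alternative only as long as the UCB value of that alternative stays above `a` as well, which lies
at least `γ - g` above its mean. Once the bonus is below `b = (γ - g) / 2`, this is a deviation of
the sample mean by `b`, so a Fuk-Nagaev inequality makes the number of these samples have mean less
than `C (b; n^f(b)) ≤ c / 2` and a bounded second moment. The strict inequality comes from the
Gaussian term of the Fuk-Nagaev bound, whose rate is four times the one in `C`. By Chebyshev's
inequality all suboptimal alternatives together then take less than half of the budget with
probability tending to one, and alternative `1` is selected on `{U₁* ≥ a}`.

The distributions being continuous, `Pr {U₁* ≥ μ₁ - g}` is continuous in `g > 0`, which allows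
passing to the supremum `γ₀`. It is positive because a random walk with positive drift has a
positive probability of never becoming negative.
-/

theorem exp_le_one_add_add_exp_mul_sq {q v : ℝ} (hq : 0 ≤ q) (hv : v ≤ q) :
    Real.exp v ≤ 1 + v + Real.exp q * v ^ 2 / 2 := by
  set g : ℝ → ℝ := fun t => 1 + t + Real.exp q * t ^ 2 / 2 - Real.exp t with hg
  have hderiv : ∀ t, HasDerivAt g (1 + Real.exp q * t - Real.exp t) t := fun t => by
    have h := (((hasDerivAt_id' t).const_add 1).add
      ((((hasDerivAt_id' t).pow 2).const_mul (Real.exp q)).div_const 2)).sub (Real.hasDerivAt_exp t)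
    exact h.congr_deriv (by simp only [Nat.cast_ofNat]; ring)
  have hdiff : Differentiable ℝ g := fun t => (hderiv t).differentiableAt
  have hanti : AntitoneOn g (Set.Iic 0) := by
    refine antitoneOn_of_deriv_nonpos (convex_Iic 0) hdiff.continuous.continuousOn
      hdiff.differentiableOn fun t ht => ?_
    have ht0 : t ∈ Set.Iic 0 := interior_subset ht
    rw [(hderiv t).deriv]
    nlinarith [Set.mem_Iic.1 ht0, Real.add_one_le_exp t, Real.one_le_exp hq]
  have hmono : MonotoneOn g (Set.Icc 0 q) := by
    refine monotoneOn_of_deriv_nonneg (convex_Icc 0 q) hdiff.continuous.continuousOn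
      hdiff.differentiableOn fun t ht => ?_
    obtain ⟨ht0, htq⟩ : t ∈ Set.Icc 0 q := interior_subset ht
    have hmul : Real.exp t * (1 - t) ≤ 1 := by
      calc Real.exp t * (1 - t) ≤ Real.exp t * Real.exp (-t) := by
            gcongr; exact Real.one_sub_le_exp_neg t
        _ = 1 := by rw [← Real.exp_add, add_neg_cancel, Real.exp_zero]
    rw [(hderiv t).deriv]
    nlinarith [Real.exp_le_exp.2 htq]
  have hg0 : g 0 = 0 := by simp [hg]
  have hgv : g 0 ≤ g v := by
    rcases le_total v 0 with h | h
    · exact hanti h Set.self_mem_Iic h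
    · exact hmono ⟨le_rfl, hq⟩ ⟨h, hv⟩ h
  rw [hg0] at hgv
  exact sub_nonneg.1 hgv

theorem monotoneOn_exp_div_rpow {q : ℝ} (hq : 0 < q) :
    MonotoneOn (fun v => Real.exp v / v ^ q) (Set.Ici q) := by
  intro v (hv : q ≤ v) w _ hvw
  have hv0 : 0 < v := hq.trans_le hv
  have hw0 : 0 < w := hv0.trans_le hvw
  have hlog : q * (Real.log w - Real.log v) ≤ w - v :=
    calc q * (Real.log w - Real.log v) = q * Real.log (w / v) := by
          rw [Real.log_div hw0.ne' hv0.ne']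
      _ ≤ q * (w / v - 1) := by gcongr; exact Real.log_le_sub_one_of_pos (by positivity)
      _ ≤ v * (w / v - 1) := by gcongr; rw [sub_nonneg, one_le_div hv0]; exact hvw
      _ = w - v := by field_simp
  simp only [Real.rpow_def_of_pos hv0, Real.rpow_def_of_pos hw0, ← Real.exp_sub]
  exact Real.exp_le_exp.2 (by linarith)

section Moments

theorem add_rpow_le_two_rpow_mul {a b q : ℝ} (ha : 0 ≤ a) (hb : 0 ≤ b) (hq : 1 ≤ q) :
    (a + b) ^ q ≤ 2 ^ (q - 1) * (a ^ q + b ^ q) := by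
  lift a to NNReal using ha
  lift b to NNReal using hb
  exact_mod_cast NNReal.rpow_add_le_mul_rpow_add_rpow a b hq

theorem max_add_zero_rpow_le {q m : ℝ} (hq : 1 ≤ q) (hm : 0 < m) (x : ℝ) :
    max (x + m) 0 ^ q ≤ 2 ^ (q - 1) * (|x| ^ q + m ^ (q - 1) * (x + m)) := by
  have hq0 : 0 < q := one_pos.trans_le hq
  have h2 : 1 ≤ (2 : ℝ) ^ (q - 1) := Real.one_le_rpow one_le_two (by linarith)
  have hsplit {t : ℝ} (ht : 0 < t) : t ^ q = t ^ (q - 1) * t := by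
    rw [← Real.rpow_add_one ht.ne', sub_add_cancel]
  rcases le_total 0 x with hx | hx
  · rw [max_eq_left (by positivity), abs_of_nonneg hx]
    calc (x + m) ^ q ≤ 2 ^ (q - 1) * (x ^ q + m ^ q) :=
          add_rpow_le_two_rpow_mul hx hm.le hq
      _ ≤ 2 ^ (q - 1) * (x ^ q + m ^ (q - 1) * (x + m)) := by
          rw [hsplit hm]; gcongr; linarith
  · rcases lt_or_ge 0 (x + m) with hxm | hxm
    · rw [max_eq_left hxm.le]
      calc (x + m) ^ q = (x + m) ^ (q - 1) * (x + m) := hsplit hxm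
        _ ≤ m ^ (q - 1) * (x + m) := by gcongr; linarith
        _ ≤ |x| ^ q + m ^ (q - 1) * (x + m) := by simp only [le_add_iff_nonneg_left]; positivity
        _ ≤ 2 ^ (q - 1) * (|x| ^ q + m ^ (q - 1) * (x + m)) :=
          le_mul_of_one_le_left (by positivity) h2
    · have hmx : m ≤ |x| := by rw [abs_of_nonpos hx]; linarith
      have hle : m ^ (q - 1) * |x| ≤ |x| ^ q := by
        rw [hsplit (hm.trans_le hmx)]; gcongr
      rw [max_eq_right hxm, Real.zero_rpow hq0.ne']
      rw [abs_of_nonpos hx] at hle ⊢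
      have : 0 < m ^ (q - 1) := by positivity
      apply mul_nonneg (by positivity)
      nlinarith

variable {ν : Measure ℝ} {q M : ℝ}

theorem memLp_id_of_integrable_abs_rpow (hq : 0 < q) (hint : Integrable (fun x => |x| ^ q) ν) :
    MemLp id (ENNReal.ofReal q) ν := by
  rw [← integrable_norm_rpow_iff aestronglyMeasurable_id (by simpa using hq) ENNReal.ofReal_ne_top,
    ENNReal.toReal_ofReal hq.le]
  exact hint

variable [IsProbabilityMeasure ν]

theorem memLp_two_id_of_integrable_abs_rpow (hq : 2 ≤ q) (hint : Integrable (fun x => |x| ^ q) ν) :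
    MemLp id 2 ν :=
  (memLp_id_of_integrable_abs_rpow (by linarith) hint).mono_exponent
    (by rw [← ENNReal.ofReal_ofNat]; exact ENNReal.ofReal_le_ofReal hq)

theorem integrable_id_of_integrable_abs_rpow (hq : 1 ≤ q) (hint : Integrable (fun x => |x| ^ q) ν) :
    Integrable (fun x => x) ν :=
  (memLp_id_of_integrable_abs_rpow (by linarith) hint).integrable
    (by rw [← ENNReal.ofReal_one]; exact ENNReal.ofReal_le_ofReal hq)

theorem integral_sq_le_rpow (hq : 2 ≤ q) (hint : Integrable (fun x => |x| ^ q) ν)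
    (hM : ∫ x, |x| ^ q ∂ν ≤ M) : ∫ x, x ^ 2 ∂ν ≤ M ^ (2 / q) := by
  have hq0 : 0 < q := by linarith
  have hsq (x : ℝ) : (x ^ 2) ^ (q / 2) = |x| ^ q := by
    rw [← sq_abs, ← Real.rpow_natCast_mul (abs_nonneg x)]
    congr 1
    push_cast
    ring
  have hjensen : (∫ x, x ^ 2 ∂ν) ^ (q / 2) ≤ ∫ x, |x| ^ q ∂ν := by
    simp only [← hsq] at hint ⊢
    exact (convexOn_rpow (by linarith)).map_integral_le
      (Real.continuous_rpow_const (by positivity)).continuousOn isClosed_Ici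
      (ae_of_all _ fun x => sq_nonneg x) (memLp_two_id_of_integrable_abs_rpow hq (by
        simpa only [hsq] using hint)).integrable_sq hint
  have hnn : 0 ≤ ∫ x, x ^ 2 ∂ν := integral_nonneg fun x => sq_nonneg x
  calc ∫ x, x ^ 2 ∂ν = ((∫ x, x ^ 2 ∂ν) ^ (q / 2)) ^ (2 / q) := by
        rw [← Real.rpow_mul hnn, div_mul_div_cancel₀ two_ne_zero, div_self hq0.ne', Real.rpow_one]
    _ ≤ M ^ (2 / q) := by gcongr; exact hjensen.trans hM

theorem variance_id_le_rpow (hq : 2 ≤ q) (hint : Integrable (fun x => |x| ^ q) ν)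
    (hM : ∫ x, |x| ^ q ∂ν ≤ M) : variance id ν ≤ M ^ (2 / q) :=
  (variance_le_expectation_sq aestronglyMeasurable_id).trans (integral_sq_le_rpow hq hint hM)

theorem max_sub_zero_rpow_le (hq : 1 ≤ q) (μ : ℝ) :
    ∃ c, ∀ x, max (x - μ) 0 ^ q ≤ 2 ^ (q - 1) * |x| ^ q + c * (x - μ) := by
  rcases le_or_gt 0 μ with hμ | hμ
  · refine ⟨0, fun x => ?_⟩
    calc max (x - μ) 0 ^ q ≤ |x| ^ q := by
          gcongr
          exact max_le (by linarith [le_abs_self x]) (abs_nonneg x)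
      _ ≤ 2 ^ (q - 1) * |x| ^ q :=
          le_mul_of_one_le_left (by positivity) (Real.one_le_rpow one_le_two (by linarith))
      _ = 2 ^ (q - 1) * |x| ^ q + 0 * (x - μ) := by ring
  · refine ⟨2 ^ (q - 1) * (-μ) ^ (q - 1), fun x => ?_⟩
    have h := max_add_zero_rpow_le hq (neg_pos.2 hμ) x
    rw [← sub_eq_add_neg] at h
    linarith

theorem integrable_max_sub_zero_rpow (hq : 1 ≤ q) (hint : Integrable (fun x => |x| ^ q) ν) (μ : ℝ) :
    Integrable (fun x => max (x - μ) 0 ^ q) ν := by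
  obtain ⟨c, hc⟩ := max_sub_zero_rpow_le hq μ
  have haff : Integrable (fun x => c * (x - μ)) ν :=
    ((integrable_id_of_integrable_abs_rpow hq hint).sub (integrable_const μ)).const_mul c
  refine ((hint.const_mul (2 ^ (q - 1))).add haff).mono'
    (Measurable.aestronglyMeasurable (by fun_prop)) (ae_of_all _ fun x => ?_)
  rw [Real.norm_of_nonneg (by positivity)]
  exact hc x

/- The affine term of the pointwise bound integrates to zero at the mean. -/
theorem integral_max_sub_mean_rpow_le (hq : 1 ≤ q) (hint : Integrable (fun x => |x| ^ q) ν) :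
    ∫ x, max (x - ∫ y, y ∂ν) 0 ^ q ∂ν ≤ 2 ^ (q - 1) * ∫ x, |x| ^ q ∂ν := by
  set μ := ∫ y, y ∂ν
  obtain ⟨c, hc⟩ := max_sub_zero_rpow_le hq μ
  have hid : Integrable (fun x => x) ν := integrable_id_of_integrable_abs_rpow hq hint
  have haff : Integrable (fun x => c * (x - μ)) ν := (hid.sub (integrable_const μ)).const_mul c
  have hzero : ∫ x, c * (x - μ) ∂ν = 0 := by
    rw [integral_const_mul, integral_sub hid (integrable_const μ), integral_const, probReal_univ,
      one_smul, sub_self, mul_zero]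
  calc ∫ x, max (x - μ) 0 ^ q ∂ν
      ≤ ∫ x, (2 ^ (q - 1) * |x| ^ q + c * (x - μ)) ∂ν :=
        integral_mono (integrable_max_sub_zero_rpow hq hint μ) ((hint.const_mul _).add haff) hc
    _ = 2 ^ (q - 1) * ∫ x, |x| ^ q ∂ν := by
        rw [integral_add (hint.const_mul _) haff, hzero, add_zero, integral_const_mul]

end Moments

section FukNagaev

/-- The weight of `E (Y⁺) ^ q` in a bound on the exponential moment at `h` of a centred random
variable `Y` cut off at the level `y`; it vanishes unless `h * y` exceeds `q`. -/
noncomputable def jumpWeight (q y h : ℝ) : ℝ := if q < h * y then Real.exp (h * y) / y ^ q else 0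

theorem jumpWeight_nonneg {q y h : ℝ} (hy : 0 ≤ y) : 0 ≤ jumpWeight q y h := by
  unfold jumpWeight; split_ifs <;> positivity

theorem exp_mul_min_le {q y h : ℝ} (hq : 0 < q) (hy : 0 < y) (hh : 0 < h) (x : ℝ) :
    Real.exp (h * min x y)
      ≤ 1 + h * x + Real.exp q * h ^ 2 / 2 * x ^ 2 + jumpWeight q y h * max x 0 ^ q := by
  have hjump : 0 ≤ jumpWeight q y h * max x 0 ^ q :=
    mul_nonneg (jumpWeight_nonneg hy.le) (by positivity)
  have hquad : 0 ≤ Real.exp q * h ^ 2 / 2 * x ^ 2 := by positivity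
  rcases le_or_gt (h * min x y) q with hsmall | hlarge
  · have hsq : min x y ^ 2 ≤ x ^ 2 := by
      rcases le_total x y with hxy | hxy
      · rw [min_eq_left hxy]
      · rw [min_eq_right hxy]; gcongr
    calc Real.exp (h * min x y)
        ≤ 1 + h * min x y + Real.exp q * (h * min x y) ^ 2 / 2 :=
          exp_le_one_add_add_exp_mul_sq hq.le hsmall
      _ = 1 + h * min x y + Real.exp q * h ^ 2 / 2 * min x y ^ 2 := by ring
      _ ≤ 1 + h * x + Real.exp q * h ^ 2 / 2 * x ^ 2 := by gcongr; exact min_le_left x y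
      _ ≤ _ := le_add_of_nonneg_right hjump
  · set w := min x y
    have hw0 : 0 < w := pos_of_mul_pos_right (hq.trans hlarge) hh.le
    have hwx : w ≤ max x 0 := (min_le_left x y).trans (le_max_left x 0)
    have hwy : h * w ≤ h * y := by gcongr; exact min_le_right x y
    have hmono : Real.exp (h * w) / (h * w) ^ q ≤ Real.exp (h * y) / (h * y) ^ q :=
      monotoneOn_exp_div_rpow hq hlarge.le (hlarge.le.trans hwy) hwy
    rw [Real.mul_rpow hh.le hw0.le, Real.mul_rpow hh.le hy.le] at hmono
    have hhx : 0 ≤ h * x := mul_nonneg hh.le (hw0.le.trans (min_le_left x y))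
    have : 0 < h ^ q := by positivity
    calc Real.exp (h * w) = Real.exp (h * w) / (h ^ q * w ^ q) * (h ^ q * w ^ q) := by field_simp
      _ ≤ Real.exp (h * y) / (h ^ q * y ^ q) * (h ^ q * w ^ q) := by gcongr
      _ = jumpWeight q y h * w ^ q := by
          rw [jumpWeight, if_pos (hlarge.trans_le hwy)]; field_simp
      _ ≤ jumpWeight q y h * max x 0 ^ q := by gcongr; exact jumpWeight_nonneg hy.le
      _ ≤ _ := by linarith

theorem mul_jumpWeight_le {q K y h : ℝ} (hK : 0 < K) (hy : 0 < y)
    (hhy : h * y ≤ Real.log (y ^ q / K)) :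
    K * jumpWeight q y h ≤ if q < h * y then 1 else 0 := by
  have : 0 < y ^ q := by positivity
  unfold jumpWeight
  split_ifs
  · calc K * (Real.exp (h * y) / y ^ q)
        ≤ K * (Real.exp (Real.log (y ^ q / K)) / y ^ q) := by gcongr
      _ = 1 := by rw [Real.exp_log (by positivity)]; field_simp
  · rw [mul_zero]

/- The Gaussian choice `h = δ / V` is optimal without jumps, but affordable only while `h * y` is at
most `log (y ^ q / K)`; beyond that, `h` is capped there and the factor `exp (-h * y)` suffices. -/
theorem exists_tilt {V K y δ q : ℝ} (hV : 0 < V) (hK : 0 < K) (hy : 0 < y) (hδ : 0 < δ)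
    (hq : 1 ≤ q) (hyδ : 2 * y ≤ q * δ) (hKy : K < y ^ q) :
    ∃ h, 0 < h ∧ Real.exp (-h * (y + δ) + V * h ^ 2 / 2 + K * jumpWeight q y h)
      ≤ Real.exp (-(δ ^ 2 / (2 * V))) + K / y ^ q := by
  have : 0 < y ^ q := by positivity
  have hlog : 0 < Real.log (y ^ q / K) := Real.log_pos (by rwa [one_lt_div hK])
  have hexp : Real.exp (-Real.log (y ^ q / K)) = K / y ^ q := by
    rw [← Real.log_inv, inv_div, Real.exp_log (by positivity)]
  set L := Real.log (y ^ q / K)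
  rcases le_or_gt (δ / V * y) L with hcase | hcase
  · refine ⟨δ / V, by positivity, ?_⟩
    have hle : K * jumpWeight q y (δ / V) ≤ δ / V * y := by
      refine (mul_jumpWeight_le hK hy hcase).trans ?_
      split_ifs with h
      · exact hq.trans h.le
      · positivity
    have hquad : -(δ / V) * δ + V * (δ / V) ^ 2 / 2 = -(δ ^ 2 / (2 * V)) := by field_simp; ring
    calc _ ≤ Real.exp (-(δ ^ 2 / (2 * V))) := Real.exp_le_exp.2 (by linarith)
      _ ≤ _ := le_add_of_nonneg_right (by positivity)
  · set h := L / y with hh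
    have hhy : h * y = L := by rw [hh]; field_simp
    have hh0 : 0 < h := by positivity
    refine ⟨h, hh0, ?_⟩
    have hVh : V * h ≤ δ := by
      rw [← hhy, mul_lt_mul_iff_left₀ hy, lt_div_iff₀ hV] at hcase
      linarith
    have hle : K * jumpWeight q y h ≤ h * δ / 2 := by
      refine (mul_jumpWeight_le hK hy hhy.le).trans ?_
      split_ifs with hqL
      · nlinarith [mul_le_mul_of_nonneg_left hyδ hh0.le]
      · positivity
    calc _ ≤ Real.exp (-L) := Real.exp_le_exp.2 (by nlinarith)
      _ = K / y ^ q := hexp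
      _ ≤ _ := le_add_of_nonneg_left (Real.exp_pos _).le

variable {Ω : Type*} [MeasurableSpace Ω] {P : Measure Ω} [IsProbabilityMeasure P]

theorem integrable_exp_mul_min {Y : Ω → ℝ} (hY : AEMeasurable Y P) {h : ℝ} (hh : 0 ≤ h) (y : ℝ) :
    Integrable (fun ω => Real.exp (h * min (Y ω) y)) P := by
  refine (integrable_const (Real.exp (h * y))).mono'
    (AEMeasurable.aestronglyMeasurable (by fun_prop)) (ae_of_all _ fun ω => ?_)
  rw [Real.norm_of_nonneg (Real.exp_pos _).le]
  gcongr
  exact min_le_right (Y ω) y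

theorem mgf_min_le {Y : Ω → ℝ} {q y h : ℝ} (hq : 0 < q) (hy : 0 < y) (hh : 0 < h)
    (hY : MemLp Y 2 P) (hmean : ∫ ω, Y ω ∂P = 0) (hpos : Integrable (fun ω => max (Y ω) 0 ^ q) P) :
    mgf (fun ω => min (Y ω) y) P h
      ≤ Real.exp (Real.exp q * h ^ 2 / 2 * ∫ ω, Y ω ^ 2 ∂P
        + jumpWeight q y h * ∫ ω, max (Y ω) 0 ^ q ∂P) := by
  have hint : Integrable (fun ω => h * Y ω) P := (hY.integrable one_le_two).const_mul h
  have hsq : Integrable (fun ω => Real.exp q * h ^ 2 / 2 * Y ω ^ 2) P :=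
    hY.integrable_sq.const_mul _
  have hlin : Integrable (fun ω => 1 + h * Y ω) P := (integrable_const 1).add hint
  have hquad : Integrable (fun ω => 1 + h * Y ω + Real.exp q * h ^ 2 / 2 * Y ω ^ 2) P :=
    hlin.add hsq
  calc mgf (fun ω => min (Y ω) y) P h
      ≤ ∫ ω, (1 + h * Y ω + Real.exp q * h ^ 2 / 2 * Y ω ^ 2
          + jumpWeight q y h * max (Y ω) 0 ^ q) ∂P :=
        integral_mono (integrable_exp_mul_min hY.aestronglyMeasurable.aemeasurable hh.le y)
          (hquad.add (hpos.const_mul _)) fun ω => exp_mul_min_le hq hy hh (Y ω)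
    _ = Real.exp q * h ^ 2 / 2 * ∫ ω, Y ω ^ 2 ∂P
          + jumpWeight q y h * ∫ ω, max (Y ω) 0 ^ q ∂P + 1 := by
        rw [integral_add hquad (hpos.const_mul _), integral_add hlin hsq,
          integral_add (integrable_const 1) hint, integral_const_mul, integral_const_mul,
          integral_const_mul, hmean, integral_const, probReal_univ, one_smul]
        ring
    _ ≤ _ := Real.add_one_le_exp _

theorem measureReal_lt_le_integral_div {Y : Ω → ℝ} {q y : ℝ} (hq : 0 ≤ q) (hy : 0 < y)
    (hpos : Integrable (fun ω => max (Y ω) 0 ^ q) P) :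
    P.real {ω | y < Y ω} ≤ (∫ ω, max (Y ω) 0 ^ q ∂P) / y ^ q := by
  rw [le_div_iff₀' (by positivity)]
  refine le_trans ?_ (mul_meas_ge_le_integral_of_nonneg
    (ae_of_all _ fun ω => by positivity) hpos (y ^ q))
  refine mul_le_mul_of_nonneg_left (measureReal_mono fun ω (hω : y < Y ω) => ?_) (by positivity)
  exact Real.rpow_le_rpow hy.le (hω.le.trans (le_max_left _ _)) hq

variable {ι : Type*} {Y : ι → Ω → ℝ} {q y V K : ℝ} {s : Finset ι}

theorem measureReal_sum_min_ge_le (hq : 0 < q) (hy : 0 < y) (hind : iIndepFun Y P)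
    (hY : ∀ j, MemLp (Y j) 2 P) (hmean : ∀ j, ∫ ω, Y j ω ∂P = 0)
    (hpos : ∀ j, Integrable (fun ω => max (Y j ω) 0 ^ q) P)
    (hV : Real.exp q * ∑ j ∈ s, ∫ ω, Y j ω ^ 2 ∂P ≤ V)
    (hK : ∑ j ∈ s, ∫ ω, max (Y j ω) 0 ^ q ∂P ≤ K) {h : ℝ} (hh : 0 < h) (x : ℝ) :
    P.real {ω | x ≤ ∑ j ∈ s, min (Y j ω) y}
      ≤ Real.exp (-h * x + V * h ^ 2 / 2 + K * jumpWeight q y h) := by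
  set Z : ι → Ω → ℝ := fun j ω => min (Y j ω) y
  have hYm (j) : AEMeasurable (Y j) P := (hY j).aestronglyMeasurable.aemeasurable
  have hZm (j) : AEMeasurable (Z j) P := (hYm j).min aemeasurable_const
  have hZ : iIndepFun Z P := hind.comp (fun _ t => min t y) fun _ => by fun_prop
  have hZint : Integrable (fun ω => Real.exp (h * (∑ j ∈ s, Z j) ω)) P := by
    have hbdd (ω) : (∑ j ∈ s, Z j) ω ≤ s.card • y := by
      rw [Finset.sum_apply]
      exact Finset.sum_le_card_nsmul s _ y fun j _ => min_le_right (Y j ω) y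
    simpa only [min_eq_left (hbdd _)] using
      integrable_exp_mul_min (s.aemeasurable_sum fun j _ => hZm j) hh.le (s.card • y)
  calc P.real {ω | x ≤ ∑ j ∈ s, Z j ω}
      ≤ Real.exp (-h * x) * mgf (∑ j ∈ s, Z j) P h := by
        simpa only [Finset.sum_apply] using measure_ge_le_exp_mul_mgf x hh.le hZint
    _ = Real.exp (-h * x) * ∏ j ∈ s, mgf (Z j) P h := by rw [hZ.mgf_sum₀ hZm]
    _ ≤ Real.exp (-h * x) * ∏ j ∈ s, Real.exp (Real.exp q * h ^ 2 / 2 * ∫ ω, Y j ω ^ 2 ∂P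
          + jumpWeight q y h * ∫ ω, max (Y j ω) 0 ^ q ∂P) := by
        gcongr with j
        · exact fun _ _ => mgf_nonneg
        · exact mgf_min_le hq hy hh (hY j) (hmean j) (hpos j)
    _ = Real.exp (-h * x + h ^ 2 / 2 * (Real.exp q * ∑ j ∈ s, ∫ ω, Y j ω ^ 2 ∂P)
          + jumpWeight q y h * ∑ j ∈ s, ∫ ω, max (Y j ω) 0 ^ q ∂P) := by
        rw [← Real.exp_sum, ← Real.exp_add, Finset.sum_add_distrib, ← Finset.mul_sum,
          ← Finset.mul_sum]
        ring_nf
    _ ≤ Real.exp (-h * x + h ^ 2 / 2 * V + jumpWeight q y h * K) := by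
        gcongr
        exact jumpWeight_nonneg hy.le
    _ = _ := by ring_nf

theorem measureReal_sum_ge_le_fukNagaev (hq : 1 ≤ q) (hy : 0 < y) (hind : iIndepFun Y P)
    (hY : ∀ j, MemLp (Y j) 2 P) (hmean : ∀ j, ∫ ω, Y j ω ∂P = 0)
    (hpos : ∀ j, Integrable (fun ω => max (Y j ω) 0 ^ q) P) (hV0 : 0 < V)
    (hV : Real.exp q * ∑ j ∈ s, ∫ ω, Y j ω ^ 2 ∂P ≤ V) (hK0 : 0 < K)
    (hK : ∑ j ∈ s, ∫ ω, max (Y j ω) 0 ^ q ∂P ≤ K) {δ : ℝ} (hδ : 0 < δ) (hyδ : 2 * y ≤ q * δ) :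
    P.real {ω | y + δ ≤ ∑ j ∈ s, Y j ω} ≤ 2 * K / y ^ q + Real.exp (-(δ ^ 2 / (2 * V))) := by
  have hq0 : 0 < q := one_pos.trans_le hq
  have hyq : 0 < y ^ q := by positivity
  rcases le_or_gt (y ^ q) K with htrivial | hKy
  · have hone : 1 ≤ K / y ^ q := by rwa [one_le_div hyq]
    calc _ ≤ 1 := measureReal_le_one
      _ ≤ 2 * (K / y ^ q) := by linarith
      _ ≤ 2 * K / y ^ q + Real.exp (-(δ ^ 2 / (2 * V))) := by
          rw [mul_div_assoc]; exact le_add_of_nonneg_right (Real.exp_pos _).le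
  obtain ⟨h, hh, htilt⟩ := exists_tilt hV0 hK0 hy hδ hq hyδ hKy
  have hjump : P.real (⋃ j ∈ s, {ω | y < Y j ω}) ≤ K / y ^ q :=
    calc _ ≤ ∑ j ∈ s, P.real {ω | y < Y j ω} := measureReal_biUnion_finset_le _ _
      _ ≤ ∑ j ∈ s, (∫ ω, max (Y j ω) 0 ^ q ∂P) / y ^ q :=
          Finset.sum_le_sum fun j _ => measureReal_lt_le_integral_div hq0.le hy (hpos j)
      _ ≤ K / y ^ q := by rw [← Finset.sum_div]; gcongr
  have hcover : {ω | y + δ ≤ ∑ j ∈ s, Y j ω}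
      ⊆ (⋃ j ∈ s, {ω | y < Y j ω}) ∪ {ω | y + δ ≤ ∑ j ∈ s, min (Y j ω) y} := by
    intro ω (hω : y + δ ≤ ∑ j ∈ s, Y j ω)
    by_cases hex : ∃ j ∈ s, y < Y j ω
    · exact Or.inl (by simpa using hex)
    · push Not at hex
      right
      rwa [Set.mem_ofPred_eq, Finset.sum_congr rfl fun j hj => min_eq_left (hex j hj)]
  calc _ ≤ _ := measureReal_mono hcover
    _ ≤ _ := measureReal_union_le _ _
    _ ≤ K / y ^ q + (Real.exp (-(δ ^ 2 / (2 * V))) + K / y ^ q) := by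
        gcongr
        exact (measureReal_sum_min_ge_le hq0 hy hind hY hmean hpos hV hK hh _).trans htilt
    _ = _ := by ring

end FukNagaev

/-- The law of the sequence of observations of an alternative with distribution `ν`. -/
noncomputable def seqLaw (ν : Measure ℝ) : Measure (ℕ → ℝ) := Measure.infinitePi fun _ : ℕ => ν

section SampleMean

theorem measurable_sampleMean (n : ℕ) : Measurable fun x : ℕ → ℝ => sampleMean x n := by
  unfold sampleMean; fun_prop

theorem measurable_ucb (f : ℕ → ℝ) (n : ℕ) : Measurable fun x : ℕ → ℝ => ucb f x n :=
  (measurable_sampleMean n).add_const _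

variable {ν : Measure ℝ} [IsProbabilityMeasure ν] {q M b : ℝ}

instance : IsProbabilityMeasure (seqLaw ν) := by unfold seqLaw; infer_instance

theorem measurePreserving_coord (j : ℕ) :
    MeasurePreserving (fun x : ℕ → ℝ => x j) (seqLaw ν) ν :=
  measurePreserving_eval_infinitePi (fun _ => ν) j

theorem iIndepFun_coord {g : ℝ → ℝ} (hg : Measurable g) :
    iIndepFun (fun (j : ℕ) (x : ℕ → ℝ) => g (x j)) (seqLaw ν) :=
  iIndepFun_infinitePi (X := fun _ => g) fun _ => hg

theorem integral_coord {g : ℝ → ℝ} (hg : Measurable g) (j : ℕ) :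
    ∫ x : ℕ → ℝ, g (x j) ∂(seqLaw ν) = ∫ y, g y ∂ν :=
  (measurePreserving_coord j).hasLaw.integral_comp hg.aestronglyMeasurable

theorem measureReal_sum_centred_ge_le (hq : 2 ≤ q) (hM : 0 < M)
    (hint : Integrable (fun x => |x| ^ q) ν) (hle : ∫ x, |x| ^ q ∂ν ≤ M) {n : ℕ} (hn : 1 ≤ n)
    {y δ : ℝ} (hy : 0 < y) (hδ : 0 < δ) (hyδ : 2 * y ≤ q * δ) :
    (seqLaw ν).real {x | y + δ ≤ ∑ j ∈ Finset.range n, (x j - ∫ t, t ∂ν)}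
      ≤ 2 * (n * (2 ^ (q - 1) * M)) / y ^ q
        + Real.exp (-(δ ^ 2 / (2 * (Real.exp q * (n * M ^ (2 / q)))))) := by
  have : (0 : ℝ) < n := by exact_mod_cast hn
  have hL2 : MemLp (fun x => x) 2 ν := memLp_two_id_of_integrable_abs_rpow hq hint
  set μ := ∫ t, t ∂ν
  have hvar : ∫ t, (t - μ) ^ 2 ∂ν ≤ M ^ (2 / q) :=
    (variance_eq_integral aemeasurable_id).symm.trans_le (variance_id_le_rpow hq hint hle)
  have hposle : ∫ t, max (t - μ) 0 ^ q ∂ν ≤ 2 ^ (q - 1) * M :=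
    (integral_max_sub_mean_rpow_le (by linarith) hint).trans (by gcongr)
  have hind : iIndepFun (fun j (x : ℕ → ℝ) => x j - μ) (seqLaw ν) :=
    iIndepFun_coord (g := fun t => t - μ) (by fun_prop)
  refine measureReal_sum_ge_le_fukNagaev (by linarith) hy hind (fun j => ?_) (fun j => ?_)
    (fun j => ?_) (by positivity) ?_ (by positivity) ?_ hδ hyδ
  · exact (hL2.sub (memLp_const μ)).comp_measurePreserving (measurePreserving_coord j)
  · rw [integral_coord (g := fun t => t - μ) (by fun_prop), integral_sub
      (hL2.integrable one_le_two) (integrable_const μ), integral_const, probReal_univ, one_smul,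
      sub_self]
  · exact (measurePreserving_coord j).integrable_comp_of_integrable
      (integrable_max_sub_zero_rpow (by linarith) hint μ)
  · simp only [integral_coord (g := fun t => (t - μ) ^ 2) (by fun_prop), Finset.sum_const,
      Finset.card_range, nsmul_eq_mul]
    gcongr
  · simp only [integral_coord (g := fun t => max (t - μ) 0 ^ q) (by fun_prop), Finset.sum_const,
      Finset.card_range, nsmul_eq_mul]
    gcongr

/-- The bound on the probability that a sample mean of size `n` exceeds the mean by `b`. -/
noncomputable def tailBound (q M b : ℝ) (n : ℕ) : ℝ :=
  momentA₁ q M * b ^ (-q) * (n : ℝ) ^ (1 - q) + Real.exp (-(n * (4 * momentC₂ q M * b ^ 2)))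

theorem momentA₁_pos (hq : 0 < q) (hM : 0 < M) : 0 < momentA₁ q M := by
  unfold momentA₁; positivity

theorem momentC₂_pos (hq : 0 < q) (hM : 0 < M) : 0 < momentC₂ q M := by
  unfold momentC₂ momentA₂; positivity

theorem tailBound_nonneg (hq : 0 < q) (hM : 0 < M) (hb : 0 < b) (n : ℕ) :
    0 ≤ tailBound q M b n := by
  have := momentA₁_pos hq hM
  unfold tailBound; positivity

/- The deviation `n b` is split into `q n b / (q + 2)` for single jumps and `2 n b / (q + 2)` for
the Gaussian regime. -/
theorem measureReal_sampleMean_ge_le (hq : 2 ≤ q) (hM : 0 < M)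
    (hint : Integrable (fun x => |x| ^ q) ν) (hle : ∫ x, |x| ^ q ∂ν ≤ M) (hb : 0 < b) {n : ℕ}
    (hn : 1 ≤ n) :
    (seqLaw ν).real {x | (∫ t, t ∂ν) + b ≤ sampleMean x n} ≤ tailBound q M b n := by
  have hq0 : 0 < q := by linarith
  have hn0 : (0 : ℝ) < n := by exact_mod_cast hn
  set y := q / (q + 2) * (n * b) with hy
  set δ := 2 / (q + 2) * (n * b) with hδ
  have hsum : y + δ = n * b := by rw [hy, hδ]; field_simp
  have hset : {x : ℕ → ℝ | (∫ t, t ∂ν) + b ≤ sampleMean x n}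
      = {x | y + δ ≤ ∑ j ∈ Finset.range n, (x j - ∫ t, t ∂ν)} := by
    ext x
    rw [Set.mem_ofPred_eq, Set.mem_ofPred_eq, sampleMean, le_div_iff₀ hn0, hsum,
      Finset.sum_sub_distrib, Finset.sum_const, Finset.card_range, nsmul_eq_mul, le_sub_iff_add_le]
    ring_nf
  have hpoly : 2 * (n * (2 ^ (q - 1) * M)) / y ^ q
      = momentA₁ q M * b ^ (-q) * (n : ℝ) ^ (1 - q) := by
    have hA : (2 + 4 / q : ℝ) = 2 * ((q + 2) / q) := by field_simp; ring
    rw [momentA₁, hA, hy, Real.mul_rpow zero_le_two (by positivity),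
      Real.mul_rpow (by positivity) (by positivity), Real.mul_rpow hn0.le hb.le,
      Real.div_rpow hq0.le (by positivity), Real.div_rpow (by positivity) hq0.le,
      Real.rpow_neg hb.le, Real.rpow_sub hn0, Real.rpow_sub two_pos, Real.rpow_one, Real.rpow_one]
    field_simp
  have hgauss : δ ^ 2 / (2 * (Real.exp q * (n * M ^ (2 / q))))
      = n * (4 * momentC₂ q M * b ^ 2) := by
    rw [hδ, momentC₂, momentA₂, neg_div, Real.rpow_neg hM.le, Real.exp_neg,
      Real.rpow_neg (by positivity), Real.rpow_ofNat]
    field_simp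
    norm_num
  rw [hset, tailBound, ← hpoly, ← hgauss]
  exact measureReal_sum_centred_ge_le hq hM hint hle hn (by positivity) (by positivity)
    (by rw [hy, hδ]; exact le_of_eq (by ring))

end SampleMean

section SizeBounds

theorem sum_Ico_rpow_neg_le {p : ℝ} (hp : 1 < p) {N : ℕ} (hN : 1 ≤ N) (B : ℕ) :
    ∑ n ∈ Finset.Ico N B, (n : ℝ) ^ (-p) ≤ (N : ℝ) ^ (1 - p) * (p / (p - 1)) := by
  have hN0 : (1 : ℝ) ≤ N := by exact_mod_cast hN
  have hp0 : 0 < p - 1 := sub_pos.2 hp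
  rcases le_or_gt B N with hBN | hNB
  · rw [Finset.Ico_eq_empty_of_le hBN, Finset.sum_empty]
    positivity
  obtain ⟨m, rfl⟩ : ∃ m, B = m + 1 := ⟨B - 1, by omega⟩
  have hNm : N ≤ m := Nat.lt_succ_iff.1 hNB
  have hNm' : (N : ℝ) ≤ m := by exact_mod_cast hNm
  have hanti : AntitoneOn (fun x : ℝ => x ^ (-p)) (Set.Icc N m) := fun x hx y _ hxy =>
    Real.rpow_le_rpow_of_nonpos (by linarith [hx.1]) hxy (by linarith)
  have hintegral : ∫ x in (N : ℝ)..m, x ^ (-p)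
      = ((N : ℝ) ^ (1 - p) - (m : ℝ) ^ (1 - p)) / (p - 1) := by
    rw [integral_rpow (Or.inr ⟨by linarith, Set.notMem_uIcc_of_lt (by linarith) (by linarith)⟩),
      ← neg_div_neg_eq]
    ring_nf
  calc ∑ n ∈ Finset.Ico N (m + 1), (n : ℝ) ^ (-p)
      = (N : ℝ) ^ (-p) + ∑ n ∈ Finset.Ico N m, ((n + 1 : ℕ) : ℝ) ^ (-p) := by
        rw [Finset.sum_eq_sum_Ico_succ_bot hNB,
          Finset.sum_Ico_add' (fun n : ℕ => (n : ℝ) ^ (-p)) N m 1]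
    _ ≤ (N : ℝ) ^ (1 - p) + ((N : ℝ) ^ (1 - p) - (m : ℝ) ^ (1 - p)) / (p - 1) := by
        rw [← hintegral]
        exact add_le_add (Real.rpow_le_rpow_of_exponent_le hN0 (by linarith))
          (hanti.sum_le_integral_Ico hNm)
    _ ≤ (N : ℝ) ^ (1 - p) + (N : ℝ) ^ (1 - p) / (p - 1) := by
        gcongr
        exact sub_le_self _ (by positivity)
    _ = (N : ℝ) ^ (1 - p) * (p / (p - 1)) := by field_simp; ring

theorem sum_Ico_exp_neg_mul_le {t : ℝ} (ht : 0 < t) (N B : ℕ) :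
    ∑ n ∈ Finset.Ico N B, Real.exp (-(n * t)) ≤ Real.exp (-(N * t)) / (1 - Real.exp (-t)) := by
  simp only [← mul_neg, Real.exp_nat_mul]
  exact geom_sum_Ico_le_of_lt_one (Real.exp_pos _).le (Real.exp_lt_one_iff.2 (neg_neg_of_pos ht))

/-- The bound on the expected number of observations of a suboptimal alternative that
`∑ tailBound` gives. -/
noncomputable def sizeBound (q M b : ℝ) (N : ℕ) : ℝ :=
  momentC₁ q M * b ^ (-q) * (N : ℝ) ^ (-q + 2)
    + Real.exp (-(N * (4 * momentC₂ q M * b ^ 2))) / (1 - Real.exp (-(4 * momentC₂ q M * b ^ 2)))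
    + N

variable {q M b : ℝ} {N : ℕ}

theorem sizeBound_lt_momentC (hq : 0 < q) (hM : 0 < M) (hb : 0 < b) (hN : 1 ≤ N) :
    sizeBound q M b N < momentC q M b N := by
  have : (0 : ℝ) < N := by exact_mod_cast hN
  have ht : 0 < momentC₂ q M * b ^ 2 := mul_pos (momentC₂_pos hq hM) (by positivity)
  have hden : 0 < 1 - Real.exp (-(momentC₂ q M * b ^ 2)) :=
    sub_pos.2 (Real.exp_lt_one_iff.2 (neg_neg_of_pos ht))
  unfold sizeBound momentC
  simp only [mul_assoc (N : ℝ), mul_assoc (4 : ℝ)]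
  set t := momentC₂ q M * b ^ 2
  have hnum : Real.exp (-(N * (4 * t))) < Real.exp (-(N * t)) := by gcongr; linarith
  have hden_le : 1 - Real.exp (-t) ≤ 1 - Real.exp (-(4 * t)) := by gcongr; linarith
  have hdiv := div_lt_div₀ hnum hden_le (Real.exp_pos _).le hden
  gcongr

theorem add_sum_Ico_tailBound_le_sizeBound (hq : 2 < q) (hM : 0 < M) (hb : 0 < b) (hN : 1 ≤ N)
    (B : ℕ) : N + ∑ n ∈ Finset.Ico N B, tailBound q M b n ≤ sizeBound q M b N := by
  have hA : 0 < momentA₁ q M := momentA₁_pos (by linarith) hM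
  have ht : 0 < 4 * momentC₂ q M * b ^ 2 := by
    have := momentC₂_pos (show 0 < q by linarith) hM
    positivity
  have hpoly := sum_Ico_rpow_neg_le (show 1 < q - 1 by linarith) hN B
  have hgauss := sum_Ico_exp_neg_mul_le ht N B
  calc N + ∑ n ∈ Finset.Ico N B, tailBound q M b n
      = momentA₁ q M * b ^ (-q) * ∑ n ∈ Finset.Ico N B, (n : ℝ) ^ (-(q - 1))
        + ∑ n ∈ Finset.Ico N B, Real.exp (-(n * (4 * momentC₂ q M * b ^ 2))) + N := by
        simp only [tailBound, Finset.sum_add_distrib, Finset.mul_sum, neg_sub]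
        ring
    _ ≤ momentA₁ q M * b ^ (-q) * ((N : ℝ) ^ (1 - (q - 1)) * ((q - 1) / (q - 1 - 1)))
        + Real.exp (-(N * (4 * momentC₂ q M * b ^ 2)))
          / (1 - Real.exp (-(4 * momentC₂ q M * b ^ 2))) + N := by gcongr
    _ = sizeBound q M b N := by
        rw [sizeBound, momentC₁, show 1 - (q - 1) = -q + 2 by ring,
          show q - 1 - 1 = q - 2 by ring]
        ring

theorem natCast_lt_momentC (hq : 2 < q) (hM : 0 < M) (hb : 0 < b) (hN : 1 ≤ N) :
    (N : ℝ) < momentC q M b N :=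
  calc (N : ℝ) ≤ sizeBound q M b N := by
        simpa using add_sum_Ico_tailBound_le_sizeBound hq hM hb hN 0
    _ < momentC q M b N := sizeBound_lt_momentC (by linarith) hM hb hN

theorem summable_mul_tailBound (hq : 3 < q) (hM : 0 < M) (hb : 0 < b) :
    Summable fun n : ℕ => (2 * n + 1 : ℝ) * tailBound q M b n := by
  have ht : 0 < 4 * momentC₂ q M * b ^ 2 := by
    have := momentC₂_pos (show 0 < q by linarith) hM
    positivity
  simp only [tailBound]
  set t := 4 * momentC₂ q M * b ^ 2
  have hgeom (k : ℕ) : Summable fun n : ℕ => (n : ℝ) ^ k * Real.exp (-(n * t)) := by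
    simp only [← mul_neg, Real.exp_nat_mul]
    refine summable_pow_mul_geometric_of_norm_lt_one k ?_
    rw [Real.norm_of_nonneg (Real.exp_pos _).le]
    exact Real.exp_lt_one_iff.2 (neg_neg_of_pos ht)
  have hpoly {p : ℝ} (hp : p < -1) : Summable fun n : ℕ => (n : ℝ) ^ p :=
    Real.summable_nat_rpow.2 hp
  set A := momentA₁ q M * b ^ (-q)
  refine ((((hpoly (p := 2 - q) (by linarith)).mul_left (2 * A)).add
    ((hpoly (p := 1 - q) (by linarith)).mul_left A)).add
    (((hgeom 1).mul_left 2).add (hgeom 0))).congr fun n => ?_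
  have hn : (n : ℝ) * (n : ℝ) ^ (1 - q) = (n : ℝ) ^ (2 - q) := by
    rcases Nat.eq_zero_or_pos n with rfl | hn
    · rw [Nat.cast_zero, zero_mul, Real.zero_rpow (by linarith)]
    · rw [show 2 - q = 1 + (1 - q) by ring, Real.rpow_add (by exact_mod_cast hn), Real.rpow_one]
  rw [← hn]
  ring

end SizeBounds

section RunLength

/-- The observation sequences on which the UCB value is at least `a` up to the sample size `n`. -/
def aboveSet (f : ℕ → ℝ) (a : ℝ) (n : ℕ) : Set (ℕ → ℝ) :=
  {x | ∀ m, 1 ≤ m → m ≤ n → a ≤ ucb f x m}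

theorem measurableSet_aboveSet (f : ℕ → ℝ) (a : ℝ) (n : ℕ) : MeasurableSet (aboveSet f a n) := by
  simp only [aboveSet, Set.ofPred_forall]
  exact MeasurableSet.iInter fun m => MeasurableSet.iInter fun _ => MeasurableSet.iInter fun _ =>
    measurableSet_le measurable_const (measurable_ucb f m)

/-- The number of sample sizes `n < B` up to which the UCB value has been at least `a`. It bounds
the number of observations that the algorithm takes from an alternative while another one keeps its
UCB value above `a`. -/
noncomputable def runLength (f : ℕ → ℝ) (a : ℝ) (B : ℕ) (x : ℕ → ℝ) : ℝ :=
  ∑ n ∈ Finset.range B, (aboveSet f a n).indicator 1 x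

theorem measurable_runLength (f : ℕ → ℝ) (a : ℝ) (B : ℕ) : Measurable (runLength f a B) :=
  Finset.measurable_sum _ fun n _ => measurable_one.indicator (measurableSet_aboveSet f a n)

theorem indicator_one_mem_Icc {α : Type*} (s : Set α) (x : α) :
    s.indicator (1 : α → ℝ) x ∈ Set.Icc (0 : ℝ) 1 :=
  ⟨Set.indicator_nonneg (fun _ _ => zero_le_one) x, Set.indicator_le_self' (by simp) x⟩

theorem sum_range_mem_Icc {e : ℕ → ℝ} (he : ∀ n, e n ∈ Set.Icc (0 : ℝ) 1) (B : ℕ) :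
    ∑ n ∈ Finset.range B, e n ∈ Set.Icc (0 : ℝ) B :=
  ⟨Finset.sum_nonneg fun n _ => (he n).1, by
    simpa using Finset.sum_le_card_nsmul (Finset.range B) e 1 fun n _ => (he n).2⟩

theorem sq_sum_range_le {e : ℕ → ℝ} (he : ∀ n, e n ∈ Set.Icc (0 : ℝ) 1) (B : ℕ) :
    (∑ n ∈ Finset.range B, e n) ^ 2 ≤ ∑ n ∈ Finset.range B, (2 * n + 1 : ℝ) * e n := by
  induction B with
  | zero => simp
  | succ B ih =>
    rw [Finset.sum_range_succ, Finset.sum_range_succ]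
    obtain ⟨he0, he1⟩ := he B
    have hle := (sum_range_mem_Icc he B).2
    nlinarith

theorem runLength_mem_Icc (f : ℕ → ℝ) (a : ℝ) (B : ℕ) (x : ℕ → ℝ) :
    runLength f a B x ∈ Set.Icc (0 : ℝ) B :=
  sum_range_mem_Icc (fun _ => indicator_one_mem_Icc _ x) B

theorem le_runLength {f : ℕ → ℝ} {a : ℝ} {B n : ℕ} {x : ℕ → ℝ} (hn : n ≤ B)
    (h : ∀ m, 1 ≤ m → m < n → a ≤ ucb f x m) : (n : ℝ) ≤ runLength f a B x := by
  have hmem {m : ℕ} (hm : m ∈ Finset.range n) : x ∈ aboveSet f a m := fun l hl hlm =>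
    h l hl (hlm.trans_lt (Finset.mem_range.1 hm))
  calc (n : ℝ) = ∑ m ∈ Finset.range n, (aboveSet f a m).indicator (1 : (ℕ → ℝ) → ℝ) x := by
        rw [Finset.sum_congr rfl fun m hm => Set.indicator_of_mem (hmem hm) _]
        simp
    _ ≤ runLength f a B x :=
        Finset.sum_le_sum_of_subset_of_nonneg (Finset.range_mono hn) fun _ _ _ =>
          (indicator_one_mem_Icc _ x).1

variable {ν : Measure ℝ} [IsProbabilityMeasure ν] {q M b a : ℝ} {f : ℕ → ℝ} {N : ℕ}

theorem memLp_runLength (f : ℕ → ℝ) (a : ℝ) (B : ℕ) : MemLp (runLength f a B) 2 (seqLaw ν) :=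
  MemLp.of_bound (measurable_runLength f a B).aestronglyMeasurable B (ae_of_all _ fun x => by
    rw [Real.norm_of_nonneg (runLength_mem_Icc f a B x).1]
    exact (runLength_mem_Icc f a B x).2)

theorem integral_sum_mul_indicator_aboveSet (f : ℕ → ℝ) (a : ℝ) (w : ℕ → ℝ) (B : ℕ) :
    ∫ x, ∑ n ∈ Finset.range B, w n * (aboveSet f a n).indicator 1 x ∂(seqLaw ν)
      = ∑ n ∈ Finset.range B, w n * (seqLaw ν).real (aboveSet f a n) := by
  have hint (n) : Integrable ((aboveSet f a n).indicator (1 : (ℕ → ℝ) → ℝ)) (seqLaw ν) :=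
    (integrable_const 1).indicator (measurableSet_aboveSet f a n)
  rw [integral_finsetSum _ fun n _ => (hint n).const_mul _]
  simp only [integral_const_mul, integral_indicator_one (measurableSet_aboveSet f a _)]

theorem measureReal_aboveSet_le (hq : 2 ≤ q) (hM : 0 < M)
    (hint : Integrable (fun x => |x| ^ q) ν) (hle : ∫ x, |x| ^ q ∂ν ≤ M) (hb : 0 < b)
    (hN : IsThreshold f b N) (ha : (∫ x, x ∂ν) + 2 * b ≤ a) {n : ℕ} (hn : N ≤ n) :
    (seqLaw ν).real (aboveSet f a n) ≤ tailBound q M b n := by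
  have hn1 : 1 ≤ n := hN.1.trans hn
  refine (measureReal_mono fun x hx => ?_).trans
    (measureReal_sampleMean_ge_le hq hM hint hle hb hn1)
  have hucb : a ≤ sampleMean x n + f n := hx n hn1 le_rfl
  have hfn := hN.2 n hn
  rw [Set.mem_ofPred_eq]
  linarith

theorem sum_mul_measureReal_aboveSet_le (hq : 2 ≤ q) (hM : 0 < M)
    (hint : Integrable (fun x => |x| ^ q) ν) (hle : ∫ x, |x| ^ q ∂ν ≤ M) (hb : 0 < b)
    (hN : IsThreshold f b N) (ha : (∫ x, x ∂ν) + 2 * b ≤ a) {w : ℕ → ℝ} (hw : ∀ n, 0 ≤ w n)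
    (B : ℕ) :
    ∑ n ∈ Finset.range B, w n * (seqLaw ν).real (aboveSet f a n)
      ≤ ∑ n ∈ Finset.range N, w n + ∑ n ∈ Finset.Ico N B, w n * tailBound q M b n := by
  set p : ℕ → ℝ := fun n => (seqLaw ν).real (aboveSet f a n)
  have hsub : Finset.range B ⊆ Finset.range N ∪ Finset.Ico N B := fun n hn => by
    rw [Finset.mem_range] at hn
    rw [Finset.mem_union, Finset.mem_range, Finset.mem_Ico]
    omega
  have hdisj : Disjoint (Finset.range N) (Finset.Ico N B) := by
    rw [Finset.range_eq_Ico]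
    exact Finset.Ico_disjoint_Ico_consecutive 0 N B
  calc ∑ n ∈ Finset.range B, w n * p n
      ≤ ∑ n ∈ Finset.range N ∪ Finset.Ico N B, w n * p n :=
        Finset.sum_le_sum_of_subset_of_nonneg hsub fun n _ _ =>
          mul_nonneg (hw n) measureReal_nonneg
    _ = ∑ n ∈ Finset.range N, w n * p n + ∑ n ∈ Finset.Ico N B, w n * p n :=
        Finset.sum_union hdisj
    _ ≤ _ := add_le_add
        (Finset.sum_le_sum fun n _ => mul_le_of_le_one_right (hw n) measureReal_le_one)
        (Finset.sum_le_sum fun n hn => mul_le_mul_of_nonneg_left (measureReal_aboveSet_le hq hM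
          hint hle hb hN ha (Finset.mem_Ico.1 hn).1) (hw n))

theorem integral_runLength_le (hq : 2 < q) (hM : 0 < M)
    (hint : Integrable (fun x => |x| ^ q) ν) (hle : ∫ x, |x| ^ q ∂ν ≤ M) (hb : 0 < b)
    (hN : IsThreshold f b N) (ha : (∫ x, x ∂ν) + 2 * b ≤ a) (B : ℕ) :
    ∫ x, runLength f a B x ∂(seqLaw ν) ≤ sizeBound q M b N :=
  calc ∫ x, runLength f a B x ∂(seqLaw ν)
      = ∑ n ∈ Finset.range B, 1 * (seqLaw ν).real (aboveSet f a n) := by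
        rw [← integral_sum_mul_indicator_aboveSet]
        simp only [runLength, one_mul]
    _ ≤ ∑ n ∈ Finset.range N, 1 + ∑ n ∈ Finset.Ico N B, 1 * tailBound q M b n :=
        sum_mul_measureReal_aboveSet_le hq.le hM hint hle hb hN ha (fun _ => zero_le_one) B
    _ = N + ∑ n ∈ Finset.Ico N B, tailBound q M b n := by simp
    _ ≤ sizeBound q M b N := add_sum_Ico_tailBound_le_sizeBound hq hM hb hN.1 B

/-- The bound on the second moment of the number of observations of a suboptimal alternative. -/
noncomputable def sizeSqBound (q M b : ℝ) (N : ℕ) : ℝ :=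
  ∑ n ∈ Finset.range N, (2 * n + 1 : ℝ) + ∑' n : ℕ, (2 * n + 1 : ℝ) * tailBound q M b n

theorem integral_runLength_sq_le (hq : 3 < q) (hM : 0 < M)
    (hint : Integrable (fun x => |x| ^ q) ν) (hle : ∫ x, |x| ^ q ∂ν ≤ M) (hb : 0 < b)
    (hN : IsThreshold f b N) (ha : (∫ x, x ∂ν) + 2 * b ≤ a) (B : ℕ) :
    ∫ x, runLength f a B x ^ 2 ∂(seqLaw ν) ≤ sizeSqBound q M b N := by
  have hindint (n : ℕ) : Integrable (fun x => (2 * n + 1 : ℝ)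
      * (aboveSet f a n).indicator (1 : (ℕ → ℝ) → ℝ) x) (seqLaw ν) :=
    ((integrable_const 1).indicator (measurableSet_aboveSet f a n)).const_mul _
  calc ∫ x, runLength f a B x ^ 2 ∂(seqLaw ν)
      ≤ ∫ x, ∑ n ∈ Finset.range B, (2 * n + 1 : ℝ) * (aboveSet f a n).indicator 1 x ∂(seqLaw ν) :=
        integral_mono (memLp_runLength f a B).integrable_sq
          (integrable_finsetSum _ fun n _ => hindint n)
          fun x => sq_sum_range_le (fun _ => indicator_one_mem_Icc _ x) B
    _ = ∑ n ∈ Finset.range B, (2 * n + 1 : ℝ) * (seqLaw ν).real (aboveSet f a n) :=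
        integral_sum_mul_indicator_aboveSet f a _ B
    _ ≤ ∑ n ∈ Finset.range N, (2 * n + 1 : ℝ)
          + ∑ n ∈ Finset.Ico N B, (2 * n + 1 : ℝ) * tailBound q M b n :=
        sum_mul_measureReal_aboveSet_le (by linarith) hM hint hle hb hN ha
          (fun n => by positivity) B
    _ ≤ sizeSqBound q M b N := by
        unfold sizeSqBound
        gcongr
        exact (summable_mul_tailBound hq hM hb).sum_le_tsum _ fun n _ =>
          mul_nonneg (by positivity) (tailBound_nonneg (by linarith) hM hb n)

end RunLength

section UCBInf

variable {ν : Measure ℝ} [IsProbabilityMeasure ν] {f : ℕ → ℝ} {a : ℝ}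

theorem ae_tendsto_sampleMean (hint : Integrable (fun x => x) ν) :
    ∀ᵐ x ∂(seqLaw ν), Tendsto (sampleMean x) atTop (𝓝 (∫ y, y ∂ν)) := by
  have hmean : ∫ x : ℕ → ℝ, x 0 ∂(seqLaw ν) = ∫ y, y ∂ν := integral_coord measurable_id 0
  have h := strong_law_ae_real (μ := seqLaw ν) (fun j (x : ℕ → ℝ) => x j)
    ((measurePreserving_coord 0).integrable_comp_of_integrable hint)
    (fun i j hij => (iIndepFun_coord measurable_id).indepFun hij)
    (fun j => (measurePreserving_coord j).hasLaw.identDistrib (measurePreserving_coord 0).hasLaw)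
  rwa [hmean] at h

theorem ae_tendsto_ucb (hf : Tendsto f atTop (𝓝 0)) (hint : Integrable (fun x => x) ν) :
    ∀ᵐ x ∂(seqLaw ν), Tendsto (ucb f x) atTop (𝓝 (∫ y, y ∂ν)) := by
  filter_upwards [ae_tendsto_sampleMean hint] with x hx
  have h := hx.add hf
  rwa [add_zero] at h

theorem measurePreserving_shift (N : ℕ) :
    MeasurePreserving (fun (x : ℕ → ℝ) j => x (N + j)) (seqLaw ν) (seqLaw ν) :=
  ⟨by fun_prop, Measure.map_infinitePi_infinitePi_of_inj (P := fun _ : ℕ => ν)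
    (add_right_injective N)⟩

theorem sum_range_sub_eq (x : ℕ → ℝ) (g : ℝ) (n : ℕ) :
    ∑ j ∈ Finset.range n, (x j - g) = n * (sampleMean x n - g) := by
  rcases Nat.eq_zero_or_pos n with rfl | hn
  · simp
  · rw [sampleMean, Finset.sum_sub_distrib, Finset.sum_const, Finset.card_range, nsmul_eq_mul]
    field_simp

theorem ae_tendsto_sum_sub_atTop (hint : Integrable (fun x => x) ν) {g : ℝ}
    (hg : g < ∫ y, y ∂ν) :
    ∀ᵐ x ∂(seqLaw ν), Tendsto (fun n => ∑ j ∈ Finset.range n, (x j - g)) atTop atTop := by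
  filter_upwards [ae_tendsto_sampleMean hint] with x hx
  simp only [sum_range_sub_eq]
  exact tendsto_natCast_atTop_atTop.atTop_mul_pos (sub_pos.2 hg) (hx.sub_const g)

/- The walk tends to infinity, so it attains its minimum, and after that time the shifted walk is
never negative; the shifted walks all have the same law. -/
theorem measure_forall_sum_sub_nonneg_pos (hint : Integrable (fun x => x) ν) {g : ℝ}
    (hg : g < ∫ y, y ∂ν) : 0 < seqLaw ν {x | ∀ n, 0 ≤ ∑ j ∈ Finset.range n, (x j - g)} := by
  rw [pos_iff_ne_zero]
  intro hzero
  have hshift (N : ℕ) : ∀ᵐ x ∂(seqLaw ν),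
      ¬ ∀ n, 0 ≤ ∑ j ∈ Finset.range n, (x (N + j) - g) := by
    have h := (measurePreserving_shift N).quasiMeasurePreserving.preimage_null hzero
    simpa only [ae_iff, not_not, Set.preimage_ofPred_eq] using h
  have hfalse : ∀ᵐ _ ∂(seqLaw ν), False := by
    filter_upwards [ae_all_iff.2 hshift, ae_tendsto_sum_sub_atTop hint hg] with x hx htop
    rw [← Nat.cofinite_eq_atTop] at htop
    obtain ⟨N, hN⟩ := htop.exists_forall_le
    refine hx N fun n => ?_
    have hmin := hN (N + n)
    rwa [Finset.sum_range_add, le_add_iff_nonneg_right] at hmin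
  exact IsProbabilityMeasure.ne_zero (seqLaw ν) (by simpa using hfalse)

theorem coe_le_ucbInf_iff {x : ℕ → ℝ} :
    (a : EReal) ≤ ucbInf f x ↔ ∀ n, 1 ≤ n → a ≤ ucb f x n := by
  simp only [ucbInf, le_iInf_iff, EReal.coe_le_coe_iff]

theorem measurableSet_le_ucbInf (f : ℕ → ℝ) (a : ℝ) :
    MeasurableSet {x : ℕ → ℝ | (a : EReal) ≤ ucbInf f x} := by
  simp only [coe_le_ucbInf_iff, Set.ofPred_forall]
  exact MeasurableSet.iInter fun m => MeasurableSet.iInter fun _ =>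
    measurableSet_le measurable_const (measurable_ucb f m)

theorem measureReal_le_ucbInf_pos (hf : ∀ n, 1 ≤ n → 0 ≤ f n) (hint : Integrable (fun x => x) ν)
    (ha : a < ∫ y, y ∂ν) : 0 < (seqLaw ν).real {x | (a : EReal) ≤ ucbInf f x} := by
  rw [measureReal_def, ENNReal.toReal_pos_iff]
  refine ⟨(measure_forall_sum_sub_nonneg_pos hint ha).trans_le (measure_mono fun x hx => ?_),
    measure_lt_top _ _⟩
  refine coe_le_ucbInf_iff.2 fun n hn => ?_
  have hn0 : (0 : ℝ) < n := by exact_mod_cast hn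
  have hmean : 0 ≤ sampleMean x n - a := by
    have h := hx n
    rwa [sum_range_sub_eq, mul_nonneg_iff_of_pos_left hn0] at h
  linarith [hf n hn, show ucb f x n = sampleMean x n + f n from rfl]

theorem ae_add_ne_of_indepFun {Ω : Type*} [MeasurableSpace Ω] {P : Measure Ω}
    [IsProbabilityMeasure P] {X Y : Ω → ℝ} (hX : AEMeasurable X P) (hY : HasLaw Y ν P)
    [NullSingletonClass ν] (hind : IndepFun X Y P) (t : ℝ) : ∀ᵐ ω ∂P, X ω + Y ω ≠ t := by
  have hS : MeasurableSet {p : ℝ × ℝ | p.1 + p.2 = t} :=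
    measurableSet_eq_fun (by fun_prop) (by fun_prop)
  have hzero : ((P.map X).prod ν) {p : ℝ × ℝ | p.1 + p.2 = t} = 0 := by
    rw [Measure.measure_prod_null hS]
    refine ae_of_all _ fun r => ?_
    have hslice : Prod.mk r ⁻¹' {p : ℝ × ℝ | p.1 + p.2 = t} = {t - r} := by
      ext y
      simp only [Set.mem_preimage, Set.mem_ofPred_eq, Set.mem_singleton_iff, eq_sub_iff_add_eq']
    simp only [hslice, measure_singleton, Pi.zero_apply]
  rw [← hY.map_eq, ← (indepFun_iff_map_prod_eq_prod_map_map hX hY.aemeasurable).1 hind,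
    Measure.map_apply_of_aemeasurable (hX.prodMk hY.aemeasurable) hS] at hzero
  simpa only [ae_iff, not_not, ne_eq, Set.preimage_ofPred_eq] using hzero

theorem ae_ucb_ne [NullSingletonClass ν] {n : ℕ} (hn : 1 ≤ n) (a : ℝ) :
    ∀ᵐ x ∂(seqLaw ν), ucb f x n ≠ a := by
  obtain ⟨m, rfl⟩ : ∃ m, n = m + 1 := ⟨n - 1, by omega⟩
  have hind : IndepFun (∑ j ∈ Finset.range m, fun x : ℕ → ℝ => x j) (fun x => x m) (seqLaw ν) :=
    (iIndepFun_coord measurable_id).indepFun_finsetSum_of_notMem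
      (fun j => measurable_pi_apply j) Finset.notMem_range_self
  have hsum := ae_add_ne_of_indepFun (by fun_prop) (measurePreserving_coord m).hasLaw hind
    ((a - f (m + 1)) * (m + 1 : ℕ))
  filter_upwards [hsum] with x hx heq
  rw [Finset.sum_apply, ← Finset.sum_range_succ] at hx
  refine hx ?_
  rw [← heq, ucb, sampleMean, add_sub_cancel_right, div_mul_cancel₀ _ (by positivity)]

theorem eventually_forall_le_iff_of_tendsto {u : ℕ → ℝ} {μ : ℝ} (hu : Tendsto u atTop (𝓝 μ))
    (ha : a < μ) (hne : ∀ n, 1 ≤ n → u n ≠ a) :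
    ∀ᶠ a' in 𝓝 a, (∀ n, 1 ≤ n → a' ≤ u n) ↔ ∀ n, 1 ≤ n → a ≤ u n := by
  obtain ⟨r, har, hrμ⟩ := exists_between ha
  obtain ⟨N, hN⟩ := (hu.eventually (lt_mem_nhds hrμ)).exists_forall_of_atTop
  have hsmall : ∀ᶠ a' in 𝓝 a, ∀ n ∈ Finset.Ico 1 N, a' ≤ u n ↔ a ≤ u n := by
    rw [Filter.eventually_all_finset]
    intro n hn
    rcases (hne n (Finset.mem_Ico.1 hn).1).lt_or_gt with h | h
    · filter_upwards [lt_mem_nhds h] with a' ha'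
      exact iff_of_false ha'.not_ge h.not_ge
    · filter_upwards [gt_mem_nhds h] with a' ha'
      exact iff_of_true ha'.le h.le
  filter_upwards [hsmall, gt_mem_nhds har] with a' hiff har'
  refine forall₂_congr fun n hn => ?_
  rcases lt_or_ge n N with hnN | hnN
  · exact hiff n (Finset.mem_Ico.2 ⟨hn, hnN⟩)
  · exact iff_of_true (har'.trans (hN n hnN)).le (har.trans (hN n hnN)).le

theorem continuousAt_measureReal_le_ucbInf [NullSingletonClass ν] (hf : Tendsto f atTop (𝓝 0))
    (hint : Integrable (fun x => x) ν) (ha : a < ∫ y, y ∂ν) :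
    ContinuousAt (fun a : ℝ => (seqLaw ν).real {x | (a : EReal) ≤ ucbInf f x}) a := by
  refine (ENNReal.tendsto_toReal (measure_ne_top _ _)).comp
    (tendsto_measure_of_ae_tendsto_indicator_of_isFiniteMeasure (𝓝 a) (measurableSet_le_ucbInf f a)
      (fun a' => measurableSet_le_ucbInf f a') ?_)
  have hne : ∀ᵐ x ∂(seqLaw ν), ∀ n, 1 ≤ n → ucb f x n ≠ a :=
    ae_all_iff.2 fun n => ae_all_iff.2 fun hn => ae_ucb_ne hn a
  filter_upwards [hne, ae_tendsto_ucb hf hint] with x hxne hxlim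
  simpa only [Set.mem_ofPred_eq, coe_le_ucbInf_iff] using
    eventually_forall_le_iff_of_tendsto hxlim ha hxne

end UCBInf

section Algorithm

variable {ι : Type*} [Fintype ι] [DecidableEq ι] {f : ℕ → ℝ} {x : ι → ℕ → ℝ} {B : ℕ}

theorem MetaUCBReachable.one_le {n : ι → ℕ} (h : MetaUCBReachable f x B n) (i : ι) : 1 ≤ n i := by
  induction h with
  | init => exact le_rfl
  | step n s _ _ _ ih =>
    rcases eq_or_ne i s with rfl | hi
    · rw [Function.update_self]
      exact Nat.le_add_left 1 _
    · rwa [Function.update_of_ne hi]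

theorem MetaUCBReachable.le_budget {n : ι → ℕ} (h : MetaUCBReachable f x B n) (hB : 1 ≤ B)
    (i : ι) : n i ≤ B := by
  induction h with
  | init => exact hB
  | step n s _ hlt _ ih =>
    rcases eq_or_ne i s with rfl | hi
    · rw [Function.update_self]
      exact (Finset.single_le_sum (fun j _ => Nat.zero_le (n j)) (Finset.mem_univ i)).trans_lt hlt
    · rwa [Function.update_of_ne hi]

theorem MetaUCBReachable.le_ucb {n : ι → ℕ} (h : MetaUCBReachable f x B n) {i₀ : ι} {a : ℝ}
    (ha : ∀ m, 1 ≤ m → a ≤ ucb f (x i₀) m) (i : ι) :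
    ∀ m, 1 ≤ m → m < n i → a ≤ ucb f (x i) m := by
  induction h with
  | init => exact fun m h1 h2 => absurd h2 h1.not_gt
  | step n s hn _ hs ih =>
    intro m h1 h2
    rcases eq_or_ne i s with rfl | hi
    · rw [Function.update_self] at h2
      rcases Nat.lt_succ_iff_lt_or_eq.1 h2 with hm | rfl
      · exact ih m h1 hm
      · exact (ha _ (hn.one_le i₀)).trans (hs i₀)
    · rw [Function.update_of_ne hi] at h2
      exact ih m h1 h2

theorem MetaUCBOutputs.eq_of_sum_runLength_lt {b : ι} (h : MetaUCBOutputs f x B b) {i₀ : ι} {a : ℝ}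
    (ha : ∀ m, 1 ≤ m → a ≤ ucb f (x i₀) m)
    (hB : 2 * ∑ i ∈ Finset.univ.erase i₀, runLength f a B (x i) < B) : b = i₀ := by
  obtain ⟨n, hn, hend, hmax⟩ := h
  have hnonneg (i) (_ : i ∈ Finset.univ.erase i₀) : 0 ≤ runLength f a B (x i) :=
    (runLength_mem_Icc f a B (x i)).1
  have hB1 : 1 ≤ B := by
    have hB0 : (0 : ℝ) < B := by linarith [Finset.sum_nonneg hnonneg]
    exact_mod_cast hB0
  have hle (i) : (n i : ℝ) ≤ runLength f a B (x i) :=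
    le_runLength (hn.le_budget hB1 i) (hn.le_ucb ha i)
  have hbudget : (B : ℝ) ≤ n i₀ + ∑ i ∈ Finset.univ.erase i₀, (n i : ℝ) := by
    rw [Finset.add_sum_erase _ (fun i => (n i : ℝ)) (Finset.mem_univ i₀)]
    exact_mod_cast hend
  have hothers : ∑ i ∈ Finset.univ.erase i₀, (n i : ℝ)
      ≤ ∑ i ∈ Finset.univ.erase i₀, runLength f a B (x i) := Finset.sum_le_sum fun i _ => hle i
  by_contra hb
  have hnb : (n b : ℝ) ≤ ∑ i ∈ Finset.univ.erase i₀, runLength f a B (x i) :=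
    (hle b).trans (Finset.single_le_sum hnonneg (Finset.mem_erase.2 ⟨hb, Finset.mem_univ b⟩))
  have hni₀ : (n i₀ : ℝ) ≤ n b := by exact_mod_cast hmax i₀
  linarith

end Algorithm

theorem measureReal_sum_ge_le_of_pairwise_indepFun {Ω ι : Type*} [MeasurableSpace Ω]
    {P : Measure Ω} [IsProbabilityMeasure P] {W : ι → Ω → ℝ} {s : Finset ι} {D V η : ℝ}
    (hs : s.Nonempty) (hη : 0 < η) (hW : ∀ i ∈ s, MemLp (W i) 2 P)
    (hind : Set.Pairwise s fun i j => IndepFun (W i) (W j) P)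
    (hD : ∀ i ∈ s, ∫ ω, W i ω ∂P ≤ D) (hV : ∀ i ∈ s, ∫ ω, W i ω ^ 2 ∂P ≤ V) :
    P.real {ω | s.card * (D + η) ≤ ∑ i ∈ s, W i ω} ≤ V / (s.card * η ^ 2) := by
  have : (0 : ℝ) < s.card := by exact_mod_cast hs.card_pos
  have hvar : variance (∑ i ∈ s, W i) P ≤ s.card * V := by
    rw [IndepFun.variance_sum hW hind, ← nsmul_eq_mul]
    exact Finset.sum_le_card_nsmul _ _ _ fun i hi =>
      (variance_le_expectation_sq (hW i hi).aestronglyMeasurable).trans (hV i hi)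
  have hmean : ∫ ω, (∑ i ∈ s, W i) ω ∂P ≤ s.card * D := by
    simp only [Finset.sum_apply]
    rw [integral_finsetSum _ fun i hi => (hW i hi).integrable one_le_two, ← nsmul_eq_mul]
    exact Finset.sum_le_card_nsmul _ _ _ hD
  calc P.real {ω | s.card * (D + η) ≤ ∑ i ∈ s, W i ω}
      ≤ P.real {ω | s.card * η ≤ |(∑ i ∈ s, W i) ω - ∫ ω, (∑ i ∈ s, W i) ω ∂P|} := by
        refine measureReal_mono fun ω hω => ?_
        rw [Set.mem_ofPred_eq] at hω ⊢
        refine le_trans ?_ (le_abs_self _)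
        rw [Finset.sum_apply]
        linarith
    _ ≤ variance (∑ i ∈ s, W i) P / (s.card * η) ^ 2 :=
        ENNReal.toReal_le_of_le_ofReal
          (div_nonneg (variance_nonneg _ _) (sq_nonneg (s.card * η)))
          (meas_ge_le_variance_div_sq (memLp_finsetSum' s hW) (by positivity))
    _ ≤ s.card * V / (s.card * η) ^ 2 := by gcongr
    _ = V / (s.card * η ^ 2) := by field_simp

section Sampling

variable {Ω ι : Type*} [MeasurableSpace Ω] {P : Measure Ω} [IsProbabilityMeasure P]
  {ν : ι → Measure ℝ} {X : ι → ℕ → Ω → ℝ}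

theorem IsSampling.isProbabilityMeasure (h : IsSampling P ν X) (i : ι) :
    IsProbabilityMeasure (ν i) :=
  (h.hasLaw i 0).isProbabilityMeasure_iff.1 inferInstance

section Countable

variable [Countable ι]

theorem IsSampling.hasLaw_curry (h : IsSampling P ν X) :
    HasLaw (fun ω i j => X i j ω) (Measure.infinitePi fun i => seqLaw (ν i)) P := by
  have := h.isProbabilityMeasure
  have huncurried : HasLaw (fun ω (p : ι × ℕ) => X p.1 p.2 ω)
      (Measure.infinitePi fun p : ι × ℕ => ν p.1) P :=
    h.indep.hasLaw_infinitePi (fun p => h.hasLaw p.1 p.2)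
      (aemeasurable_pi_iff.2 fun p => (h.hasLaw p.1 p.2).aemeasurable)
  have hcurry : HasLaw (MeasurableEquiv.curry ι ℕ ℝ) (Measure.infinitePi fun i => seqLaw (ν i))
      (Measure.infinitePi fun p : ι × ℕ => ν p.1) :=
    ⟨(MeasurableEquiv.curry ι ℕ ℝ).measurable.aemeasurable,
      Measure.infinitePi_map_curry fun i (_ : ℕ) => ν i⟩
  exact hcurry.comp huncurried

theorem IsSampling.hasLaw_seq (h : IsSampling P ν X) (i : ι) :
    HasLaw (fun ω j => X i j ω) (seqLaw (ν i)) P := by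
  have := h.isProbabilityMeasure
  exact (measurePreserving_eval_infinitePi (fun i => seqLaw (ν i)) i).hasLaw.comp h.hasLaw_curry

theorem IsSampling.iIndepFun_seq (h : IsSampling P ν X) : iIndepFun (fun i ω j => X i j ω) P := by
  have := h.isProbabilityMeasure
  exact (iIndepFun_iff_hasLaw_Pi_infinitePi h.hasLaw_seq h.hasLaw_curry.aemeasurable).2
    h.hasLaw_curry

theorem IsSampling.measureReal_le_ucbInf (h : IsSampling P ν X) (i : ι) (f : ℕ → ℝ) (a : ℝ) :
    P.real {ω | (a : EReal) ≤ ucbInf f (fun j => X i j ω)}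
      = (seqLaw (ν i)).real {x | (a : EReal) ≤ ucbInf f x} :=
  (h.hasLaw_seq i).measureReal_eq (measurableSet_le_ucbInf f a)

theorem IsSampling.measureReal_sum_runLength_ge_le (h : IsSampling P ν X) {f : ℕ → ℝ}
    {a D V η : ℝ} {B : ℕ} {s : Finset ι} (hs : s.Nonempty) (hη : 0 < η)
    (hD : ∀ i ∈ s, ∫ x, runLength f a B x ∂(seqLaw (ν i)) ≤ D)
    (hV : ∀ i ∈ s, ∫ x, runLength f a B x ^ 2 ∂(seqLaw (ν i)) ≤ V) :
    P.real {ω | s.card * (D + η) ≤ ∑ i ∈ s, runLength f a B (fun j => X i j ω)}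
      ≤ V / (s.card * η ^ 2) := by
  have := h.isProbabilityMeasure
  have hmeas := measurable_runLength f a B
  refine measureReal_sum_ge_le_of_pairwise_indepFun hs hη (fun i _ => ?_)
    (fun i _ j _ hij => (h.iIndepFun_seq.comp (fun _ => runLength f a B) fun _ => hmeas).indepFun
      hij)
    (fun i hi => ((h.hasLaw_seq i).integral_comp hmeas.aestronglyMeasurable).trans_le (hD i hi))
    (fun i hi => ((h.hasLaw_seq i).integral_comp
      (hmeas.pow_const 2).aestronglyMeasurable).trans_le (hV i hi))
  have hLp := memLp_runLength (ν := ν i) f a B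
  rw [← (h.hasLaw_seq i).map_eq] at hLp
  exact hLp.comp_of_map (h.hasLaw_seq i).aemeasurable

end Countable

theorem IsSampling.measureReal_le_ucbInf_le_add [Fintype ι] [DecidableEq ι] [Nontrivial ι]
    (h : IsSampling P ν X) {f : ℕ → ℝ} {i₀ : ι} {a D V η : ℝ} {B : ℕ} (hη : 0 < η)
    (hD : ∀ i, i ≠ i₀ → ∫ x, runLength f a B x ∂(seqLaw (ν i)) ≤ D)
    (hV : ∀ i, i ≠ i₀ → ∫ x, runLength f a B x ^ 2 ∂(seqLaw (ν i)) ≤ V)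
    (hB : 2 * ((Finset.univ.erase i₀).card * (D + η)) ≤ B) {out : Ω → ι}
    (hout : ∀ᵐ ω ∂P, MetaUCBOutputs f (fun i j => X i j ω) B (out ω)) :
    (seqLaw (ν i₀)).real {x | (a : EReal) ≤ ucbInf f x}
      ≤ P.real {ω | out ω = i₀} + V / ((Finset.univ.erase i₀).card * η ^ 2) := by
  set s := Finset.univ.erase i₀
  have hs : s.Nonempty := (exists_ne i₀).imp fun i hi => Finset.mem_erase.2 ⟨hi, Finset.mem_univ i⟩
  set long : Set Ω := {ω | s.card * (D + η) ≤ ∑ i ∈ s, runLength f a B (fun j => X i j ω)}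
  have hcover : ({ω | (a : EReal) ≤ ucbInf f (fun j => X i₀ j ω)} : Set Ω)
      ≤ᵐ[P] ({ω | out ω = i₀} ∪ long : Set Ω) := by
    filter_upwards [hout] with ω hω habove
    rcases le_or_gt (s.card * (D + η)) (∑ i ∈ s, runLength f a B (fun j => X i j ω)) with
      hlong | hshort
    · exact Or.inr hlong
    · exact Or.inl (hω.eq_of_sum_runLength_lt (coe_le_ucbInf_iff.1 habove) (by linarith))
  calc (seqLaw (ν i₀)).real {x | (a : EReal) ≤ ucbInf f x}
      = P.real {ω | (a : EReal) ≤ ucbInf f (fun j => X i₀ j ω)} :=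
        (h.measureReal_le_ucbInf i₀ f a).symm
    _ ≤ P.real ({ω | out ω = i₀} ∪ long) :=
        ENNReal.toReal_mono (measure_ne_top _ _) (measure_mono_ae hcover)
    _ ≤ P.real {ω | out ω = i₀} + P.real long := measureReal_union_le _ _
    _ ≤ P.real {ω | out ω = i₀} + V / (s.card * η ^ 2) := by
        gcongr
        exact h.measureReal_sum_runLength_ge_le hs hη
          (fun i hi => hD i (Finset.ne_of_mem_erase hi))
          (fun i hi => hV i (Finset.ne_of_mem_erase hi))

end Sampling

theorem continuousAt_momentC {q M b : ℝ} (hq : 0 < q) (hM : 0 < M) (hb : 0 < b) (N : ℕ) :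
    ContinuousAt (fun b => momentC q M b N) b := by
  have hc := momentC₂_pos hq hM
  have hne : 1 - Real.exp (-(momentC₂ q M * b ^ 2)) ≠ 0 :=
    (sub_pos.2 (Real.exp_lt_one_iff.2 (neg_lt_zero.2 (by positivity)))).ne'
  unfold momentC
  refine ContinuousAt.add (ContinuousAt.add ?_ ?_) continuousAt_const
  · exact (continuousAt_const.mul (Real.continuousAt_rpow_const b (-q) (Or.inl hb.ne'))).mul
      continuousAt_const
  · exact ContinuousAt.div (by fun_prop) (by fun_prop) hne

theorem admissibleSet_nonempty {q M γ c : ℝ} {nf : ℝ → ℕ} (hq : 0 < q) (hM : 0 < M) (hγ : 0 < γ)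
    (hnf_left : ∀ᶠ b in 𝓝[<] (γ / 2), nf b = nf (γ / 2))
    (hc : 2 * momentC q M (γ / 2) (nf (γ / 2)) < c) : (admissibleSet q M γ c nf).Nonempty := by
  have hcost : ∀ᶠ b in 𝓝 (γ / 2), 2 * momentC q M b (nf (γ / 2)) < c :=
    ((continuousAt_momentC hq hM (half_pos hγ) (nf (γ / 2))).const_mul 2).eventually
      (gt_mem_nhds hc)
  have hpos : ∀ᶠ b in 𝓝 (γ / 2), 0 < b := lt_mem_nhds (half_pos hγ)
  have hlt : ∀ᶠ b in 𝓝[<] (γ / 2), b < γ / 2 := self_mem_nhdsWithin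
  obtain ⟨b, ⟨hbc, hb0⟩, hbnf, hbγ⟩ :=
    (((hcost.and hpos).filter_mono nhdsWithin_le_nhds).and (hnf_left.and hlt)).exists
  refine ⟨γ - 2 * b, ⟨by linarith, by linarith⟩, ?_⟩
  rw [show (γ - (γ - 2 * b)) / 2 = b by ring, hbnf]
  exact hbc.le

theorem le_liminf_of_sub_le {L : ℝ} {u v : ℕ → ℝ} (hv : Tendsto v atTop (𝓝 0))
    (hu : ∀ k, u k ≤ 1) (h : ∀ᶠ k in atTop, L - v k ≤ u k) : L ≤ liminf u atTop := by
  have hlim := hv.const_sub L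
  rw [sub_zero] at hlim
  rw [← hlim.liminf_eq]
  exact liminf_le_liminf h hlim.isBoundedUnder_ge (isBoundedUnder_of ⟨1, hu⟩).isCoboundedUnder_ge

section Selection

variable {Ω : Type*} [MeasurableSpace Ω] {P : Measure Ω} [IsProbabilityMeasure P]
  {ν : (k : ℕ) → Fin (k + 1) → Measure ℝ} {X : (k : ℕ) → Fin (k + 1) → ℕ → Ω → ℝ}

theorem measureReal_le_liminf_of_mem_admissibleSet (hX : ∀ k, IsSampling P (ν k) (X k))
    {ν₁ : Measure ℝ} (hν₁ : ∀ k, ν k 0 = ν₁) {f : ℕ → ℝ} {q M : ℝ} (hq : 3 < q) (hM : 0 < M)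
    (hmoment : ∀ k i, i ≠ 0 →
      Integrable (fun x : ℝ => |x| ^ q) (ν k i) ∧ ∫ x, |x| ^ q ∂(ν k i) ≤ M)
    {γ : ℝ} (hgap : ∀ k (i : Fin (k + 1)), i ≠ 0 → γ ≤ (∫ x, x ∂(ν k 0)) - ∫ x, x ∂(ν k i))
    {nf : ℝ → ℕ} (hnf : ∀ b, 0 < b → IsThreshold f b (nf b)) {c : ℝ} {B : ℕ → ℕ}
    (hB : ∀ k, c * k ≤ B k) {out : (k : ℕ) → Ω → Fin (k + 1)}
    (hout : ∀ k, ∀ᵐ ω ∂P, MetaUCBOutputs f (fun i j => X k i j ω) (B k) (out k ω))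
    {g : ℝ} (hg : g ∈ admissibleSet q M γ c nf) :
    (seqLaw ν₁).real {x | (((∫ y, y ∂ν₁) - g : ℝ) : EReal) ≤ ucbInf f x}
      ≤ liminf (fun k => P.real {ω | out k ω = 0}) atTop := by
  obtain ⟨⟨-, hgγ⟩, hgc⟩ := hg
  set b := (γ - g) / 2 with hb
  have hb0 : 0 < b := by linarith
  have hthr : IsThreshold f b (nf b) := hnf b hb0
  set D := sizeBound q M b (nf b)
  have hDc : D < momentC q M b (nf b) := sizeBound_lt_momentC (by linarith) hM hb0 hthr.1
  set η := (c / 2 - D) / 2 with hη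
  have hη0 : 0 < η := by linarith
  have hv : Tendsto (fun k : ℕ => sizeSqBound q M b (nf b) / (k * η ^ 2)) atTop (𝓝 0) :=
    (tendsto_natCast_atTop_atTop.atTop_mul_const (by positivity)).const_div_atTop _
  refine le_liminf_of_sub_le hv (fun k => measureReal_le_one) ?_
  filter_upwards [eventually_ge_atTop 1] with k hk
  have := (hX k).isProbabilityMeasure
  have : NeZero k := ⟨by omega⟩
  have hcard : (Finset.univ.erase (0 : Fin (k + 1))).card = k := by simp
  have hmean (i) (hi : i ≠ 0) : (∫ x, x ∂(ν k i)) + 2 * b ≤ (∫ y, y ∂ν₁) - g := by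
    have hgapi := hgap k i hi
    rw [hν₁ k] at hgapi
    linarith
  have hbudget : 2 * ((Finset.univ.erase (0 : Fin (k + 1))).card * (D + η)) ≤ B k := by
    rw [hcard]
    have hle : (k : ℝ) * (D + η) ≤ k * (c / 2) := by gcongr; linarith
    linarith [hB k]
  have hbound := (hX k).measureReal_le_ucbInf_le_add (i₀ := 0) hη0
    (fun i hi => integral_runLength_le (by linarith) hM (hmoment k i hi).1 (hmoment k i hi).2 hb0
      hthr (hmean i hi) (B k))
    (fun i hi => integral_runLength_sq_le hq hM (hmoment k i hi).1 (hmoment k i hi).2 hb0 hthr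
      (hmean i hi) (B k))
    hbudget (hout k)
  rw [hcard, hν₁ k] at hbound
  linarith

theorem mul_natCast_le_of_two_mul_momentC_lt {q M b c : ℝ} {N k B : ℕ} (hq : 2 < q) (hM : 0 < M)
    (hb : 0 < b) (hN : 1 ≤ N) (hc : 2 * momentC q M b N < c) (hB : |(B : ℝ) - c * (k + 1)| < 1) :
    c * k ≤ B := by
  have hN1 : (1 : ℝ) ≤ N := by exact_mod_cast hN
  have hc1 : 1 ≤ c := by linarith [natCast_lt_momentC hq hM hb hN]
  linarith [(abs_lt.1 hB).1]

theorem theorem2_general (hX : ∀ k, IsSampling P (ν k) (X k))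
    {ν₁ : Measure ℝ} (hν₁ : ∀ k, ν k 0 = ν₁) {f : ℕ → ℝ} (hf : IsBonus f) {q M : ℝ} (hq : 3 < q)
    (hM : 0 < M) (hcont : ∀ x, ν₁ {x} = 0) (hint : Integrable (fun x : ℝ => x) ν₁)
    (hmoment : ∀ k i, i ≠ 0 →
      Integrable (fun x : ℝ => |x| ^ q) (ν k i) ∧ ∫ x, |x| ^ q ∂(ν k i) ≤ M)
    {γ : ℝ} (hγ : 0 < γ)
    (hgap : ∀ k (i : Fin (k + 1)), i ≠ 0 → γ ≤ (∫ x, x ∂(ν k 0)) - ∫ x, x ∂(ν k i))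
    {nf : ℝ → ℕ} (hnf : ∀ b, 0 < b → IsThreshold f b (nf b))
    (hnf_left : ∀ᶠ b in 𝓝[<] (γ / 2), nf b = nf (γ / 2))
    {c : ℝ} (hc : 2 * momentC q M (γ / 2) (nf (γ / 2)) < c)
    {B : ℕ → ℕ} (hB : ∀ k, c * k ≤ B k) {out : (k : ℕ) → Ω → Fin (k + 1)}
    (hout : ∀ k, ∀ᵐ ω ∂P, MetaUCBOutputs f (fun i j => X k i j ω) (B k) (out k ω)) :
    ∃ γ₀ : ℝ, IsLUB (admissibleSet q M γ c nf) γ₀ ∧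
      (∀ m, P.real {ω | (((∫ x, x ∂ν₁) - γ₀ : ℝ) : EReal) ≤ ucbInf f (fun j => X m 0 j ω)}
          ≤ liminf (fun k => P.real {ω | out k ω = 0}) atTop) ∧
      (∀ m, 0 < P.real {ω | (((∫ x, x ∂ν₁) - γ₀ : ℝ) : EReal)
          ≤ ucbInf f (fun j => X m 0 j ω)}) ∧
      (∃ α ∈ Set.Ioo (0 : ℝ) 1,
        α < liminf (fun k => P.real {ω | out k ω = 0}) atTop) := by
  have hprob : IsProbabilityMeasure ν₁ := hν₁ 0 ▸ (hX 0).isProbabilityMeasure 0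
  have hatoms : NullSingletonClass ν₁ := ⟨hcont⟩
  have hne := admissibleSet_nonempty (by linarith) hM hγ hnf_left hc
  obtain ⟨γ₀, hlub⟩ := Real.exists_isLUB hne ⟨γ, fun g hg => hg.1.2.le⟩
  have hγ₀ : 0 < γ₀ := hne.elim fun g hg => hg.1.1.trans_le (hlub.1 hg)
  set p : ℝ → ℝ := fun g => (seqLaw ν₁).real {x | (((∫ y, y ∂ν₁) - g : ℝ) : EReal) ≤ ucbInf f x}
  have hlaw (m) : P.real {ω | (((∫ x, x ∂ν₁) - γ₀ : ℝ) : EReal) ≤ ucbInf f (fun j => X m 0 j ω)}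
      = p γ₀ := by
    rw [(hX m).measureReal_le_ucbInf, hν₁ m]
  have hpos : 0 < p γ₀ := measureReal_le_ucbInf_pos hf.nonneg hint (sub_lt_self _ hγ₀)
  have hp : ContinuousAt p γ₀ :=
    (continuousAt_measureReal_le_ucbInf hf.tendsto_zero hint (sub_lt_self _ hγ₀)).comp
      (continuousAt_const.sub continuousAt_id)
  have hle : p γ₀ ≤ liminf (fun k => P.real {ω | out k ω = 0}) atTop :=
    le_of_tendsto_of_frequently hp ((hlub.frequently_nhds_mem hne).mono fun g hg =>
      measureReal_le_liminf_of_mem_admissibleSet hX hν₁ hq hM hmoment hgap hnf hB hout hg)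
  exact ⟨γ₀, hlub, fun m => (hlaw m).trans_le hle, fun m => hpos.trans_eq (hlaw m).symm, p γ₀ / 2,
    ⟨half_pos hpos, by linarith [show p γ₀ ≤ 1 from measureReal_le_one]⟩,
    (half_lt_self hpos).trans_le hle⟩

end Selection

/-- The problem with index `k` has `k + 1` alternatives, and alternative `0` is the best one. -/
theorem theorem2 {Ω : Type*} [MeasurableSpace Ω] (P : Measure Ω) [IsProbabilityMeasure P]
    -- the distributions of the alternatives and their observations, for every problem size
    (ν : (k : ℕ) → Fin (k + 1) → Measure ℝ)
    (X : (k : ℕ) → Fin (k + 1) → ℕ → Ω → ℝ)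
    (hX : ∀ k, IsSampling P (ν k) (X k))
    -- the distribution of the best alternative does not change with the problem size
    (ν₁ : Measure ℝ) (hν₁ : ∀ k, ν k 0 = ν₁)
    -- the bonus function
    (f : ℕ → ℝ) (hf : IsBonus f)
    -- continuous distributions with bounded absolute moments of order `q > 3`
    (q M : ℝ) (hq : 3 < q) (hM : 0 < M)
    (hcont : ∀ k i (x : ℝ), ν k i {x} = 0)
    (hmoment : ∀ k i, Integrable (fun x : ℝ => |x| ^ q) (ν k i) ∧ ∫ x, |x| ^ q ∂(ν k i) ≤ M)
    -- indifference zone and variance bounds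
    (γ σlo σhi : ℝ) (hγ : 0 < γ) (hσlo : 0 < σlo) (hσhi : 0 < σhi)
    (hgap : ∀ k (i : Fin (k + 1)), i ≠ 0 → γ ≤ (∫ x, x ∂(ν k 0)) - ∫ x, x ∂(ν k i))
    (hvar : ∀ k i, σlo ^ 2 ≤ variance id (ν k i) ∧ variance id (ν k i) ≤ σhi ^ 2)
    -- a choice of the thresholds `n^f(b)`, locally constant to the left of `γ / 2`
    -- (the least thresholds have this property)
    (nf : ℝ → ℕ) (hnf : ∀ b, 0 < b → IsThreshold f b (nf b))
    (hnf_left : ∀ᶠ b in 𝓝[<] (γ / 2), nf b = nf (γ / 2))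
    -- the total budget is `c` times the number of alternatives, rounded up or down
    (c : ℝ) (hc : 2 * momentC q M (γ / 2) (nf (γ / 2)) < c)
    (B : ℕ → ℕ) (hB : ∀ k, |(B k : ℝ) - c * (k + 1)| < 1)
    -- the output of the meta-UCB algorithm, with any tie-breaking
    (out : (k : ℕ) → Ω → Fin (k + 1))
    (hout : ∀ k, ∀ᵐ ω ∂P, MetaUCBOutputs f (fun i j => X k i j ω) (B k) (out k ω)) :
    ∃ γ₀ : ℝ, IsLUB (admissibleSet q M γ c nf) γ₀ ∧
      -- the law of `U_1^*` is the same in all the problems, so any index `m` may be used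
      (∀ m, P.real {ω | (((∫ x, x ∂ν₁) - γ₀ : ℝ) : EReal) ≤ ucbInf f (fun j => X m 0 j ω)}
          ≤ liminf (fun k => P.real {ω | out k ω = 0}) atTop) ∧
      (∀ m, 0 < P.real {ω | (((∫ x, x ∂ν₁) - γ₀ : ℝ) : EReal)
          ≤ ucbInf f (fun j => X m 0 j ω)}) ∧
      -- sample optimality
      (∃ α ∈ Set.Ioo (0 : ℝ) 1,
        α < liminf (fun k => P.real {ω | out k ω = 0}) atTop) := by
  have hprob := (hX 0).isProbabilityMeasure 0
  exact theorem2_general hX hν₁ hf hq hM (hν₁ 0 ▸ hcont 0 0)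
    (hν₁ 0 ▸ integrable_id_of_integrable_abs_rpow (by linarith) (hmoment 0 0).1)
    (fun k i _ => hmoment k i) hγ hgap hnf hnf_left hc
    (fun k => mul_natCast_le_of_two_mul_momentC_lt (by linarith) hM (half_pos hγ)
      (hnf _ (half_pos hγ)).1 hc (hB k)) hout
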